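/- **Definitions.** A *lattice* is a discrete subgroup $L$ of a finite-dimensional real inner product space. A morphism $f:L\to M$ of lattices is a group homomorphism with $\|f(x)\|\le\|x\|$ for all $x\in L$; this gives the category $\mathbf{Lat}$, which has a zero object and in which the group-theoretic kernel $\operatorname{Ker} f=\{x\in L: f(x)=0\}$ is a kernel of $f$. Put $$\rho(L)=\sum_{x\in L}e^{-\pi\|x\|^2},\qquad \ell(L)=\ln\rho(L),\qquad \operatorname{nul}(f)=\ell(\operatorname{Ker}f),\qquad \operatorname{rk}(f)=\ell(L)-\ell(\operatorname{Ker} f).$$ A *rank* on a category is a function $\operatorname{rk}$ from morphisms to nonnegative reals with $\operatorname{rk}(g\circ f)\le\operatorname{rk}(f)$ and $\operatorname{rk}(g\circ f)\le\operatorname{rk}(g)$. A sequence $0\to A\xrightarrow{f}B\xrightarrow{g}C\to0$ is *short exact* if $f$ is a kernel of $g$ and $g$ is a cokernel of $f$. A real sequence $(e_k)_{k\ge0}$ is *numerically exact* if $e_k\ge0$ and $\sum_{j=0}^{k}(-1)^je_{k-j}\ge0$ for all $k\ge 0$. A *numerical $\delta$-functor* on $\mathbf{Lat}$ is a sequence $T=(T^0,T^1,\dots)$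 of functions from lattices to nonnegative reals such that for every short exact sequence $0\to A\to B\to C\to0$ the sequence $T^0(A),T^0(B),T^0(C),T^1(A),T^1(B),T^1(C),T^2(A),\dots$ is numerically exact. It is *effaceable* if for all $i\ge1$, every lattice $A$ and every $\epsilon>0$ there is a short exact sequence $0\to A\to B\to C\to0$ with $T^i(B)\le\epsilon$. A lattice $L$ whose real span has dimension $d$ is *$\delta$-tight* if it is generated by vectors of norm at most $\delta/d^2$ (the zero lattice is always $\delta$-tight). For lattices $L,M$, the lattice $L\otimes M$ is the subgroup generated by the tensors $x\otimes y$ ($x\in L$, $y\in M$) in the tensor product of the ambient inner product spaces. For $n\ge1$ let $P_n\subset\mathbb R^2$ be the lattice generated by $(\tfrac1n,0)$ and $\bigl(0,\sqrt{\tfrac1{n^2}-\tfrac1{n^4}}\bigr)$, embed $\mathbb Z$ in $P_n$ by $1\mapsto u_n=\bigl(\tfrac1n,\sqrt{1-\tfrac1{n^2}}\bigr)$, and let $P_n/\mathbb Z$ be the orthogonal projection of $P_n$ onto $u_n^{\perp}$. For a lattice $L$ let $R_{(L,n)}$ be the complex $$0\to P_n\otimes L\to(P_n/\mathbb Z)\otimes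 L\to0\to0\to\cdots$$ obtained by tensoring the projection with $L$. For a complex $0\xrightarrow{a_0}A_1\xrightarrow{a_1}A_2\xrightarrow{a_2}\cdots$ put $h^k_\bullet(A)=\operatorname{nul}(a_{k+1})-\operatorname{rk}(a_k)$. **Theorem (cohomology exists on $\mathbf{Lat}$).** 1. For every lattice $L$ the sum $\rho(L)$ converges; $\operatorname{rk}$ is a rank on $\mathbf{Lat}$; and $\operatorname{rk}(\mathrm{id}_L)=\ell(L)$. 2. For all $n\ge1$ and all lattices $L$, the sequence $0\to L\to P_n\otimes L\to(P_n/\mathbb Z)\otimes L\to0$, with first map $x\mapsto u_n\otimes x$, is short exact. For every lattice $L$ and every $\delta>0$, the lattices $P_n\otimes L$ and $(P_n/\mathbb Z)\otimes L$ are $\delta$-tight for all sufficiently large $n$. 3. There is an effaceable numerical $\delta$-functor $h=(h^0,h^1,\dots)$ on $\mathbf{Lat}$ with $h^0=\ell$, and $$h^k(L)=\lim_{n\to\infty}h^k_\bullet\bigl(R_{(L,n)}\bigr)$$ for every lattice $L$ and every $k\ge0$ (in particular the limits exist). Moreover, every effaceable numerical $\delta$-functor $T$ on $\mathbf{Lat}$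 with $T^0=\ell$ equals $h$. -/

import Mathlib

open CategoryTheory CategoryTheory.Limits Filter Topology
open scoped TensorProduct

universe u v w

/-! ### Numerical exact sequences and numerical delta-functors -/

/-- The alternating sums `e k - e (k-1) + e (k-2) - ...` and all terms are nonnegative. -/
def IsNumericalExact (e : ℕ → ℝ) : Prop :=
  (∀ k, 0 ≤ e k) ∧ ∀ k, 0 ≤ ∑ j ∈ Finset.range (k + 1), (-1 : ℝ) ^ j * e (k - j)

/-- The sequence `T⁰(A), T⁰(B), T⁰(C), T¹(A), T¹(B), T¹(C), T²(A), ...`. -/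
def longSequence {O : Type u} (T : ℕ → O → ℝ) (A B C : O) (k : ℕ) : ℝ :=
  if k % 3 = 0 then T (k / 3) A else if k % 3 = 1 then T (k / 3) B else T (k / 3) C

/-- `T = (T⁰, T¹, ...)` is a numerical delta-functor for the class of triples `E`. -/
def IsNumericalDeltaFunctor {O : Type u} (E : O → O → O → Prop) (T : ℕ → O → ℝ) : Prop :=
  (∀ i A, 0 ≤ T i A) ∧ ∀ A B C, E A B C → IsNumericalExact (longSequence T A B C)

/-- The function `F` can be made arbitrarily small on the middle term of a triple. -/
def IsEffaceable {O : Type u} (E : O → O → O → Prop) (F : O → ℝ) : Prop :=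
  ∀ A, ∀ ε : ℝ, 0 < ε → ∃ B C, E A B C ∧ F B ≤ ε

/-- An effaceable numerical delta-functor. -/
def IsEffaceableDeltaFunctor {O : Type u} (E : O → O → O → Prop) (T : ℕ → O → ℝ) : Prop :=
  IsNumericalDeltaFunctor E T ∧ ∀ i, 1 ≤ i → IsEffaceable E (T i)

/-! ### Ranks and short exact sequences in a category -/

/-- `rk` is a rank on the category `C`. -/
def IsRank {C : Type u} [Category.{v} C] (rk : ∀ ⦃A B : C⦄, (A ⟶ B) → ℝ) : Prop :=
  (∀ (A B : C) (f : A ⟶ B), 0 ≤ rk f) ∧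
    ∀ (A B D : C) (f : A ⟶ B) (g : B ⟶ D), rk (f ≫ g) ≤ rk f ∧ rk (f ≫ g) ≤ rk g

/-- `0 ⟶ A ⟶ B ⟶ D ⟶ 0` is short exact: `f` is a kernel of `g` and `g` is a cokernel of `f`. -/
def IsShortExact {C : Type u} [Category.{v} C] [HasZeroMorphisms C] {A B D : C}
    (f : A ⟶ B) (g : B ⟶ D) : Prop :=
  ∃ hfg : f ≫ g = 0,
    Nonempty (IsLimit (KernelFork.ofι f hfg)) ∧ Nonempty (IsColimit (CokernelCofork.ofπ g hfg))

/-- The class of triples `(A, B, D)` that are the terms of a short exact sequence. -/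
def ShortExactTriple (C : Type u) [Category.{v} C] [HasZeroMorphisms C] (A B D : C) : Prop :=
  ∃ (f : A ⟶ B) (g : B ⟶ D), IsShortExact f g

/-! ### Discrete subgroups of Euclidean spaces: auxiliary facts -/

/-- A discrete subgroup is generated by a finite linearly independent family. -/
theorem exists_linearIndependent_span_int {V : Type u} [NormedAddCommGroup V]
    [InnerProductSpace ℝ V] [FiniteDimensional ℝ V] (L : Submodule ℤ V) [DiscreteTopology L] :
    ∃ (d : ℕ) (b : Fin d → V), LinearIndependent ℝ b ∧
      Submodule.span ℤ (Set.range b) = L := by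
  have hf : Module.Finite ℤ L := inferInstance
  have hfr : Module.Free ℤ L := inferInstance
  let b := Module.finBasis ℤ L
  have hspan : Submodule.span ℤ (Set.range fun i => (b i : V)) = L := by
    have : (Set.range fun i => (b i : V)) = L.subtype '' Set.range b := by
      ext x; simp
    rw [this, ← Submodule.map_span, b.span_eq]; simp
  refine ⟨_, fun i => (b i : V), ?_, hspan⟩
  have hd : DiscreteTopology (Submodule.span ℤ (Set.range fun i => (b i : V))) := by
    rw [hspan]; infer_instance
  have h := Real.finrank_eq_int_finrank_of_discrete hd
  rw [linearIndependent_iff_card_eq_finrank_span, h, Set.finrank, hspan]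
  simp

/-- The integral span of a finite linearly independent family is discrete. -/
theorem discrete_span_int {V : Type u} [NormedAddCommGroup V] [InnerProductSpace ℝ V]
    {ι : Type w} [Finite ι] {b : ι → V} (hb : LinearIndependent ℝ b) :
    DiscreteTopology (Submodule.span ℤ (Set.range b)) := by
  let e := Module.Basis.span hb
  have hfin : FiniteDimensional ℝ (Submodule.span ℝ (Set.range b)) :=
    FiniteDimensional.span_of_finite ℝ (Set.finite_range b)
  have hmap : (Submodule.span ℤ (Set.range b)) =
      (Submodule.span ℤ (Set.range e)).map
        ((Submodule.span ℝ (Set.range b)).subtype.restrictScalars ℤ) := by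
    rw [Submodule.map_span]
    congr 1
    rw [← Set.range_comp]
    congr 1
    funext i
    exact congrArg Subtype.val (Module.Basis.span_apply hb i).symm
  have hmem : ∀ x : Submodule.span ℤ (Set.range b),
      (x : V) ∈ Submodule.span ℝ (Set.range b) := fun x =>
    Submodule.span_le_restrictScalars ℤ ℝ _ x.2
  have hmem2 : ∀ x : Submodule.span ℤ (Set.range b),
      (⟨x, hmem x⟩ : Submodule.span ℝ (Set.range b)) ∈ Submodule.span ℤ (Set.range e) := by
    intro x
    have hx : (x : V) ∈ (Submodule.span ℤ (Set.range e)).map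
        ((Submodule.span ℝ (Set.range b)).subtype.restrictScalars ℤ) := hmap ▸ x.2
    obtain ⟨y, hy, hyx⟩ := hx
    have : y = ⟨x, hmem x⟩ := Subtype.ext hyx
    rwa [← this]
  refine DiscreteTopology.of_continuous_injective
    (f := fun x : Submodule.span ℤ (Set.range b) =>
      (⟨⟨x, hmem x⟩, hmem2 x⟩ : Submodule.span ℤ (Set.range e))) ?_ ?_
  · fun_prop
  · intro x y h
    exact Subtype.ext (congrArg (fun z => ((z : Submodule.span ℝ (Set.range b)) : V)) (congrArg
      Subtype.val h))

/-- The subgroup generated by the pure tensors of two discrete subgroups is discrete. -/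
theorem discrete_tensor {V : Type u} [NormedAddCommGroup V] [InnerProductSpace ℝ V]
    [FiniteDimensional ℝ V] {W : Type v} [NormedAddCommGroup W] [InnerProductSpace ℝ W]
    [FiniteDimensional ℝ W] (L : Submodule ℤ V) [DiscreteTopology L]
    (M : Submodule ℤ W) [DiscreteTopology M] :
    DiscreteTopology (Submodule.span ℤ
      (Set.image2 (fun x y => x ⊗ₜ[ℝ] y) (L : Set V) (M : Set W))) := by
  obtain ⟨d, b, hb, hbL⟩ := exists_linearIndependent_span_int L
  obtain ⟨e, c, hc, hcM⟩ := exists_linearIndependent_span_int M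
  have hbc : LinearIndependent ℝ (fun p : Fin d × Fin e => b p.1 ⊗ₜ[ℝ] c p.2) :=
    hb.tmul_of_isDomain hc
  have hspan : Submodule.span ℤ (Set.image2 (fun x y => x ⊗ₜ[ℝ] y) (L : Set V) (M : Set W)) =
      Submodule.span ℤ (Set.range fun p : Fin d × Fin e => b p.1 ⊗ₜ[ℝ] c p.2) := by
    let B : V →ₗ[ℤ] W →ₗ[ℤ] (V ⊗[ℝ] W) :=
      (TensorProduct.mk ℝ V W).restrictScalars₁₂ ℤ ℤ
    have h1 := Submodule.map₂_span_span ℤ B (Set.range b) (Set.range c)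
    rw [hbL, hcM] at h1
    have h2 := Submodule.map₂_eq_span_image2 B L M
    rw [h1] at h2
    have h3 : (Set.range fun p : Fin d × Fin e => b p.1 ⊗ₜ[ℝ] c p.2) =
        Set.image2 (fun x y => B x y) (Set.range b) (Set.range c) := by
      ext z
      simp [B, Set.mem_image2]
    rw [h3]
    exact h2.symm
  rw [hspan]
  exact discrete_span_int hbc

/-- The orthogonal projection of a discrete subgroup `L` onto the orthogonal complement of the
span of a subgroup `K ≤ L` is discrete. -/
theorem discrete_quotient {V : Type u} [NormedAddCommGroup V] [InnerProductSpace ℝ V]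
    [FiniteDimensional ℝ V] (L K : Submodule ℤ V) [DiscreteTopology L] (hK : K ≤ L) :
    DiscreteTopology (L.map
      (((Submodule.span ℝ (K : Set V))ᗮ.starProjection : V →ₗ[ℝ] V).restrictScalars ℤ)) := by
  have hKd : DiscreteTopology K :=
    DiscreteTopology.of_continuous_injective (f := fun x : K => (⟨x, hK x.2⟩ : L))
      (by fun_prop) (fun x y h => Subtype.ext (congrArg (fun z : L => (z : V)) h))
  obtain ⟨d, b, hb, hbK⟩ := exists_linearIndependent_span_int K
  set S := Submodule.span ℝ (K : Set V) with hS
  set P : V →ₗ[ℤ] V := ((Sᗮ.starProjection : V →ₗ[ℝ] V).restrictScalars ℤ) with hP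
  have hSb : Submodule.span ℝ (Set.range b) = S := by
    rw [hS, ← hbK, Submodule.span_span_of_tower]
  -- every vector of the span of `K` is within distance `R` of `K`
  obtain ⟨R, hR⟩ : ∃ R : ℝ, ∀ y ∈ S, ∃ k ∈ K, ‖y - k‖ ≤ R := by
    refine ⟨∑ i, ‖b i‖, fun y hy => ?_⟩
    rw [← hSb, Submodule.mem_span_range_iff_exists_fun] at hy
    obtain ⟨c, rfl⟩ := hy
    refine ⟨∑ i, ⌊c i⌋ • b i, ?_, ?_⟩
    · refine Submodule.sum_mem _ fun i _ => Submodule.smul_mem _ _ ?_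
      rw [← hbK]
      exact Submodule.subset_span ⟨i, rfl⟩
    · rw [← Finset.sum_sub_distrib]
      refine (norm_sum_le _ _).trans (Finset.sum_le_sum fun i _ => ?_)
      rw [← Int.cast_smul_eq_zsmul ℝ, ← sub_smul, norm_smul, Int.self_sub_floor, Real.norm_eq_abs,
        abs_of_nonneg (Int.fract_nonneg _)]
      exact mul_le_of_le_one_left (norm_nonneg _) (Int.fract_lt_one _).le
  -- so only finitely many points of the projection lie in the unit ball
  have hLfin : (Metric.closedBall (0 : V) (R + 1) ∩ (L : Set V)).Finite := by
    change ((_ : Set V) ∩ (L.toAddSubgroup : Set V)).Finite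
    have : DiscreteTopology L.toAddSubgroup := (inferInstance : DiscreteTopology L)
    exact Metric.finite_isBounded_inter_isClosed DiscreteTopology.isDiscrete
      Metric.isBounded_closedBall inferInstance
  have hfin : ((L.map P : Set V) ∩ Metric.ball 0 1).Finite := by
    refine (hLfin.image P).subset ?_
    rintro v ⟨⟨x, hx, rfl⟩, hv⟩
    have hxS : x - P x ∈ S := by
      have h := Submodule.starProjection_orthogonal_val (K := S) x
      have h' : P x = x - S.starProjection x := h
      rw [h', sub_sub_cancel]
      exact Submodule.starProjection_apply_mem S x
    obtain ⟨k, hk, hkR⟩ := hR _ hxS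
    have hPk : P k = 0 := by
      have : Sᗮ.starProjection k = 0 := by
        rw [Submodule.starProjection_apply_eq_zero_iff]
        exact Submodule.le_orthogonal_orthogonal S (Submodule.subset_span hk)
      exact this
    refine ⟨x - k, ⟨?_, L.sub_mem hx (hK hk)⟩, ?_⟩
    · rw [mem_closedBall_zero_iff]
      have : x - k = (x - P x - k) + P x := by abel
      rw [this]
      refine (norm_add_le _ _).trans (add_le_add hkR ?_)
      rw [mem_ball_zero_iff] at hv
      exact hv.le
    · rw [map_sub, hPk, sub_zero]
  refine discreteTopology_of_isOpen_singleton_zero ?_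
  have hopen : IsOpen (Metric.ball (0 : V) 1 \ (((L.map P : Set V) ∩ Metric.ball 0 1) \ {0})) :=
    Metric.isOpen_ball.sdiff (hfin.subset Set.sdiff_subset).isClosed
  convert hopen.preimage (continuous_subtype_val (p := fun x => x ∈ L.map P)) using 1
  ext ⟨x, hx⟩
  simp only [Set.mem_singleton_iff, Set.mem_preimage, Set.mem_sdiff, Set.mem_inter_iff,
    SetLike.mem_coe, not_and, not_not, Metric.mem_ball, dist_zero_right]
  constructor
  · intro h
    have h0 : x = 0 := congrArg Subtype.val h
    subst h0
    simp
  · rintro ⟨h1, h2⟩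
    exact Subtype.ext (h2 ⟨hx, h1⟩)

/-! ### The category of Euclidean lattices -/

/-- A lattice: a discrete subgroup of a finite-dimensional real inner product space. -/
structure EucLat : Type (u + 1) where
  /-- the ambient inner product space -/
  V : Type u
  [normed : NormedAddCommGroup V]
  [innerProduct : InnerProductSpace ℝ V]
  [finiteDim : FiniteDimensional ℝ V]
  /-- the subgroup -/
  carrier : Submodule ℤ V
  [discrete : DiscreteTopology carrier]

namespace EucLat

attribute [instance] normed innerProduct finiteDim discrete

/-- A lattice homomorphism: a group homomorphism of operator norm at most one. -/
@[ext]
structure Hom (L M : EucLat.{u}) where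
  /-- the underlying group homomorphism -/
  toFun : L.carrier →+ M.carrier
  norm_le : ∀ x, ‖(toFun x : M.V)‖ ≤ ‖(x : L.V)‖

instance : Category EucLat.{u} where
  Hom := Hom
  id L := ⟨AddMonoidHom.id _, fun _ => le_rfl⟩
  comp f g := ⟨g.toFun.comp f.toFun, fun x => (g.norm_le _).trans (f.norm_le x)⟩

@[ext]
theorem hom_ext {L M : EucLat.{u}} {f g : L ⟶ M} (h : ∀ x, f.toFun x = g.toFun x) : f = g :=
  Hom.ext (AddMonoidHom.ext h)

@[simp]
theorem comp_apply {L M N : EucLat.{u}} (f : L ⟶ M) (g : M ⟶ N) (x : L.carrier) :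
    (f ≫ g).toFun x = g.toFun (f.toFun x) := rfl

instance : HasZeroMorphisms EucLat.{u} where
  zero L M := ⟨⟨0, fun _ => by simp⟩⟩
  comp_zero _ _ := rfl
  zero_comp _ _ _ f := hom_ext fun _ => map_zero f.toFun

@[simp]
theorem zero_apply {L M : EucLat.{u}} (x : L.carrier) : (0 : L ⟶ M).toFun x = 0 := rfl

/-- The zero lattice. -/
noncomputable abbrev zero : EucLat.{u} where
  V := EuclideanSpace ℝ PEmpty.{u + 1}
  carrier := ⊥

theorem isZero_zero : IsZero zero.{u} := by
  rw [IsZero.iff_id_eq_zero]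
  refine hom_ext fun x => ?_
  have hx : x = 0 := Subtype.ext (Subsingleton.elim (α := EuclideanSpace ℝ PEmpty.{u + 1}) _ _)
  rw [hx, map_zero, map_zero]

instance : HasZeroObject EucLat.{u} := ⟨zero, isZero_zero⟩

/-- The group-theoretic kernel of `f`, as a sublattice of the source. -/
abbrev ker {L M : EucLat.{u}} (f : L ⟶ M) : EucLat.{u} where
  V := L.V
  carrier := f.toFun.ker.toIntSubmodule.map L.carrier.subtype
  discrete := DiscreteTopology.of_subset (s := (L.carrier : Set L.V)) L.discrete <| by
    rintro _ ⟨x, -, rfl⟩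
    exact x.2

/-- The inclusion of the kernel. -/
def kerι {L M : EucLat.{u}} (f : L ⟶ M) : ker f ⟶ L where
  toFun :=
    { toFun := fun x => ⟨x, by obtain ⟨y, -, h⟩ := x.2; exact h ▸ y.2⟩
      map_zero' := rfl
      map_add' := fun _ _ => rfl }
  norm_le _ := le_rfl

theorem kerι_comp {L M : EucLat.{u}} (f : L ⟶ M) : kerι f ≫ f = 0 := by
  refine hom_ext ?_
  rintro ⟨_, ⟨x, hx, rfl⟩⟩
  exact hx

/-- `ker f` is a kernel of `f` in the sense of category theory. -/
theorem ker_isKernel {L M : EucLat.{u}} (f : L ⟶ M) :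
    Nonempty (IsLimit (KernelFork.ofι (kerι f) (kerι_comp f))) := by
  refine ⟨KernelFork.IsLimit.ofι _ _ (fun {W} g hg => ⟨⟨⟨fun x => ⟨(g.toFun x : L.V),
    ⟨g.toFun x, ?_, rfl⟩⟩, ?_⟩, ?_⟩, ?_⟩) ?_ ?_⟩
  · exact congrArg (fun h : W ⟶ M => h.toFun x) hg
  · exact Subtype.ext (congrArg (fun z : L.carrier => (z : L.V)) (map_zero g.toFun))
  · intro x y
    exact Subtype.ext (congrArg (fun z : L.carrier => (z : L.V)) (map_add g.toFun x y))
  · intro x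
    exact g.norm_le x
  · intro W g hg
    rfl
  · intro W g hg m hm
    subst hm
    rfl

/-! ### Gaussian mass and the rank -/

/-- The Gaussian mass `ρ(L) = ∑_{x ∈ L} exp (-π ‖x‖²)`. -/
noncomputable def rho (L : EucLat.{u}) : ℝ :=
  ∑' x : L.carrier, Real.exp (-Real.pi * ‖(x : L.V)‖ ^ 2)

/-- `ℓ(L) = ln ρ(L)`. -/
noncomputable def ell (L : EucLat.{u}) : ℝ := Real.log L.rho

/-- `nul(f) = ℓ(Ker f)`. -/
noncomputable def nul ⦃L M : EucLat.{u}⦄ (f : L ⟶ M) : ℝ := (ker f).ell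

/-- `rk(f) = ℓ(L) - ℓ(Ker f)` for `f : L ⟶ M`. -/
noncomputable def rk ⦃L M : EucLat.{u}⦄ (f : L ⟶ M) : ℝ := L.ell - (ker f).ell

/-- The numerical cohomology of a complex `0 ⟶ X 0 ⟶ X 1 ⟶ ...`: the nullity of the map leaving
`X k` minus the rank of the map entering `X k`. -/
noncomputable def complexCohomology (X : CochainComplex EucLat.{u} ℕ) : ℕ → ℝ
  | 0 => nul (X.d 0 1) - rk (0 : zero ⟶ X.X 0)
  | k + 1 => nul (X.d (k + 1) (k + 2)) - rk (X.d k (k + 1))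

/-! ### Tensor products, quotients, tightness -/

/-- The lattice morphism induced by a linear contraction of the ambient spaces. -/
def ofLinear {L M : EucLat.{u}} (T : L.V →L[ℝ] M.V) (hT : ∀ x ∈ L.carrier, T x ∈ M.carrier)
    (hn : ‖T‖ ≤ 1) : L ⟶ M where
  toFun :=
    { toFun := fun x => ⟨T x, hT x x.2⟩
      map_zero' := Subtype.ext (by simp)
      map_add' := fun x y => Subtype.ext (by simp) }
  norm_le x := T.le_of_opNorm_le_of_le hn le_rfl |>.trans (one_mul _).le

/-- The tensor product lattice: the subgroup generated by the tensors `x ⊗ y` with `x ∈ L`,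
`y ∈ M`. It is formed in `L.V ⊗ M.V`, which contains `span L ⊗ span M` isometrically. -/
noncomputable abbrev tensor (L : EucLat.{u}) (M : EucLat.{v}) : EucLat.{max u v} where
  V := L.V ⊗[ℝ] M.V
  carrier := Submodule.span ℤ
    (Set.image2 (fun x y => x ⊗ₜ[ℝ] y) (L.carrier : Set L.V) (M.carrier : Set M.V))
  discrete := discrete_tensor L.carrier M.carrier

/-- The morphism `T ⊗ L : A ⊗ L ⟶ B ⊗ L` for a linear contraction `T` carrying `A` into `B`. -/
noncomputable def tensorRight (L : EucLat.{u}) {A B : EucLat.{v}} (T : A.V →L[ℝ] B.V)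
    (hT : ∀ x ∈ A.carrier, T x ∈ B.carrier) (hn : ‖T‖ ≤ 1) : A.tensor L ⟶ B.tensor L :=
  ofLinear (L := A.tensor L) (M := B.tensor L) (T.rTensor L.V)
    (fun z hz => by
      refine Submodule.span_le (p := (B.tensor L).carrier.comap
        ((T.rTensor L.V : A.V ⊗[ℝ] L.V →ₗ[ℝ] B.V ⊗[ℝ] L.V).restrictScalars ℤ)) |>.2 ?_ hz
      rintro _ ⟨x, hx, y, hy, rfl⟩
      exact Submodule.subset_span ⟨T x, hT x hx, y, hy, rfl⟩)
    ((ContinuousLinearMap.norm_rTensor_le (G := L.V) T).trans hn)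

/-- The orthogonal projection with kernel the real span of `K`. -/
noncomputable abbrev quotProj (L : EucLat.{u}) (K : Submodule ℤ L.V) : L.V →L[ℝ] L.V :=
  (Submodule.span ℝ (K : Set L.V))ᗮ.starProjection

/-- The quotient lattice `L / K`: the projection of `L` onto the orthogonal complement of the
span of `K`. -/
noncomputable abbrev quot (L : EucLat.{u}) (K : Submodule ℤ L.V) (hK : K ≤ L.carrier) :
    EucLat.{u} where
  V := L.V
  carrier := L.carrier.map ((L.quotProj K : L.V →ₗ[ℝ] L.V).restrictScalars ℤ)
  discrete := discrete_quotient L.carrier K hK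

/-- `L` is `δ`-tight: it is generated by vectors of norm at most `δ / d²`, where `d` is the
dimension of the real span of `L`. -/
def IsTight (L : EucLat.{u}) (δ : ℝ) : Prop :=
  ∃ S : Set L.V, Submodule.span ℤ S = L.carrier ∧
    ∀ x ∈ S, ‖x‖ ≤ δ / (Module.finrank ℝ (Submodule.span ℝ (L.carrier : Set L.V)) : ℝ) ^ 2

/-! ### The tight resolutions -/

/-- The generator `(1/n, 0)` of `P_n`. -/
noncomputable def genA (n : ℕ+) : EuclideanSpace ℝ (Fin 2) := !₂[1 / (n : ℝ), 0]

/-- The generator `(0, √(1/n² - 1/n⁴))` of `P_n`. -/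
noncomputable def genB (n : ℕ+) : EuclideanSpace ℝ (Fin 2) :=
  !₂[0, √(1 / (n : ℝ) ^ 2 - 1 / (n : ℝ) ^ 4)]

/-- The unit vector `(1/n, √(1 - 1/n²))`, the image of `1 ∈ ℤ` in `P_n`. -/
noncomputable def unitVec (n : ℕ+) : EuclideanSpace ℝ (Fin 2) :=
  !₂[1 / (n : ℝ), √(1 - 1 / (n : ℝ) ^ 2)]

theorem span_pair_discrete (n : ℕ+) :
    DiscreteTopology (Submodule.span ℤ {genA n, genB n}) := by
  have hn : (0 : ℝ) < n := by exact_mod_cast n.pos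
  by_cases h : √(1 / (n : ℝ) ^ 2 - 1 / (n : ℝ) ^ 4) = 0
  · have hB : genB n = 0 := by rw [genB, h]; ext i; fin_cases i <;> rfl
    have hA : LinearIndependent ℝ (fun _ : Unit => genA n) := by
      refine LinearIndependent.of_subsingleton () fun h0 => ?_
      have := congrArg (fun x : EuclideanSpace ℝ (Fin 2) => x 0) h0
      simp [genA] at this
    have := discrete_span_int hA
    have hs : Submodule.span ℤ {genA n, genB n} =
        Submodule.span ℤ (Set.range fun _ : Unit => genA n) := by
      rw [hB, Set.range_const, Set.pair_comm, Submodule.span_insert_zero]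
    rw [hs]; exact this
  · have hAB : LinearIndependent ℝ ![genA n, genB n] := by
      rw [LinearIndependent.pair_iff]
      intro s t hst
      have h0 := congrArg (fun x : EuclideanSpace ℝ (Fin 2) => x 0) hst
      have h1 := congrArg (fun x : EuclideanSpace ℝ (Fin 2) => x 1) hst
      simp [genA, genB] at h0 h1
      exact ⟨h0, h1.resolve_right (by simpa using h)⟩
    have := discrete_span_int hAB
    rwa [Matrix.range_cons_cons_empty] at this

/-- The lattice `P_n ⊆ ℝ²` generated by `(1/n, 0)` and `(0, √(1/n² - 1/n⁴))`. -/
noncomputable abbrev P (n : ℕ+) : EucLat.{0} where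
  V := EuclideanSpace ℝ (Fin 2)
  carrier := Submodule.span ℤ {genA n, genB n}
  discrete := span_pair_discrete n

theorem unitVec_mem (n : ℕ+) : unitVec n ∈ (P n).carrier := by
  have hn : (0 : ℝ) < n := by exact_mod_cast n.pos
  have h : unitVec n = genA n + (n : ℤ) • genB n := by
    have hs : √(1 - 1 / (n : ℝ) ^ 2) = n * √(1 / (n : ℝ) ^ 2 - 1 / (n : ℝ) ^ 4) := by
      rw [← Real.sqrt_sq hn.le, ← Real.sqrt_mul (sq_nonneg _), Real.sqrt_sq hn.le]
      congr 1
      field_simp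
    ext i
    fin_cases i <;> simp [unitVec, genA, genB]
    simpa using hs
  rw [h]
  exact Submodule.add_mem _ (Submodule.subset_span (by simp))
    (Submodule.smul_mem _ _ (Submodule.subset_span (by simp)))

theorem norm_unitVec (n : ℕ+) : ‖unitVec n‖ = 1 := by
  have hn : (1 : ℝ) ≤ n := by exact_mod_cast Nat.one_le_iff_ne_zero.2 n.ne_zero
  have h1 : 0 ≤ 1 - 1 / (n : ℝ) ^ 2 := by
    rw [sub_nonneg, div_le_one (by positivity)]
    exact one_le_pow₀ hn
  rw [EuclideanSpace.norm_eq, Fin.sum_univ_two, Real.sqrt_eq_one]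
  simp only [unitVec, Real.norm_eq_abs, sq_abs]
  simp only [Matrix.cons_val_zero, Matrix.cons_val_one]
  rw [Real.sq_sqrt h1]
  ring

/-- The image of `ℤ` in `P_n`: the integer multiples of the vector `(1/n, √(1 - 1/n²))`. -/
noncomputable def intInP (n : ℕ+) : Submodule ℤ (P n).V := Submodule.span ℤ {unitVec n}

theorem intInP_le (n : ℕ+) : intInP n ≤ (P n).carrier := by
  refine Submodule.span_le.2 ?_
  rintro _ rfl
  exact unitVec_mem n

/-- The quotient lattice `P_n / ℤ`. -/
noncomputable abbrev PModInt (n : ℕ+) : EucLat.{0} := (P n).quot (intInP n) (intInP_le n)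

/-- The map `L ⟶ P_n ⊗ L`, `x ↦ (1/n, √(1 - 1/n²)) ⊗ x`, i.e. the embedding `ℤ ⟶ P_n` tensored
with `L`. -/
noncomputable def augmentation (n : ℕ+) (L : EucLat.{u}) : L ⟶ (P n).tensor L :=
  ofLinear (L := L) (M := (P n).tensor L)
    (TensorProduct.mkL ℝ (EuclideanSpace ℝ (Fin 2)) L.V (unitVec n))
    (fun x hx => Submodule.subset_span ⟨unitVec n, unitVec_mem n, x, hx, rfl⟩)
    (ContinuousLinearMap.opNorm_le_bound _ zero_le_one fun x => by
      rw [TensorProduct.mkL_apply_apply, TensorProduct.norm_tmul, norm_unitVec])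

/-- The map `P_n ⊗ L ⟶ (P_n / ℤ) ⊗ L`, i.e. the projection `P_n ⟶ P_n / ℤ` tensored with `L`. -/
noncomputable def differential (n : ℕ+) (L : EucLat.{u}) :
    (P n).tensor L ⟶ (PModInt n).tensor L :=
  tensorRight L (A := P n) (B := PModInt n) ((P n).quotProj (intInP n))
    (fun x hx => ⟨x, hx, rfl⟩) (Submodule.starProjection_norm_le _)

/-- The objects of the complex `P_n ⊗ L ⟶ (P_n / ℤ) ⊗ L ⟶ 0 ⟶ 0 ⟶ ...`. -/
noncomputable def resolutionX (n : ℕ+) (L : EucLat.{u}) : ℕ → EucLat.{u}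
  | 0 => (P n).tensor L
  | 1 => (PModInt n).tensor L
  | _ + 2 => zero

/-- The maps of the complex `P_n ⊗ L ⟶ (P_n / ℤ) ⊗ L ⟶ 0 ⟶ 0 ⟶ ...`. -/
noncomputable def resolutionD (n : ℕ+) (L : EucLat.{u}) :
    ∀ k, resolutionX n L k ⟶ resolutionX n L (k + 1)
  | 0 => differential n L
  | _ + 1 => 0

/-- The complex `R_{(L,n)}`: `0 ⟶ P_n ⊗ L ⟶ (P_n / ℤ) ⊗ L ⟶ 0 ⟶ 0 ⟶ ...`. -/
noncomputable def resolution (n : ℕ+) (L : EucLat.{u}) : CochainComplex EucLat.{u} ℕ :=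
  CochainComplex.of (resolutionX n L) (resolutionD n L) fun _ => comp_zero

end EucLat

/-! The functor is explicit: `h⁰ = ℓ`, `h¹ = ℓ + log covol`, and all higher terms vanish. Poisson
summation would identify `h¹(L)` with `ℓ` of the dual lattice, but the argument uses no Fourier
analysis. Its analytic source is the parallelogram law: a pair `(x, y)` with `y - x` in the class of
`r` modulo 2 is `(s - t, r + s + t)`, and in these coordinates a product of two Gaussian weights
becomes a function of `s` times a function of `t`, so `2ab ≤ a² + b²` applies. This yields two
inequalities.

First, `theta_le`: a translate of a Gaussian sum by a vector of the real span is at most the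
untranslated sum. Together with the lower bound by a covering radius it shows that the logarithm of
the Gaussian sum of `2⁻ᵏ L`, minus `k · rank · log 2`, decreases to a finite limit `logDensity`,
which is `-log covol`. Second, `tsum_mul_tsum_le_of_parallelogram`: subgroups are positively
correlated under a Gaussian weight. Applied to the graph of a contraction `f : A → B` and to `A ×
Ker g`, it gives `rk (g ∘ f) ≤ rk g`.

A categorical short exact sequence of lattices is a short exact sequence of groups with induced norm
on the left and quotient norm on the right. Summing the Gaussian over cosets gives `ℓ(B) ≤ ℓ(A) +
ℓ(C)`, additivity of `logDensity`, and `logDensity A + ℓ(C) ≤ ℓ(B)`. With monotonicity of `ℓ` and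
`logDensity ≤ ℓ`, these are exactly the alternating sums to be checked.

Finally `h¹(L) ≤ π r²` for a covering radius `r` of `L`. Both terms of the resolution have
generators of length `O(1/n)`, so their `h¹` tends to 0; this proves effaceability, and by
additivity of `logDensity` also the limit formula. Uniqueness is formal: effaceability squeezes each
`Tⁱ⁺¹(A)` between alternating sums of lower terms. -/

open scoped ENNReal

/-! ### Sums over a free abelian group -/

/-- `exp (-r)` as an extended nonnegative real. -/
noncomputable def expNeg (r : ℝ) : ℝ≥0∞ := ENNReal.ofReal (Real.exp (-r))

theorem expNeg_add (a b : ℝ) : expNeg (a + b) = expNeg a * expNeg b := by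
  rw [expNeg, expNeg, expNeg, ← ENNReal.ofReal_mul (Real.exp_pos _).le, ← Real.exp_add, neg_add]

theorem expNeg_le_expNeg {a b : ℝ} (h : b ≤ a) : expNeg a ≤ expNeg b :=
  ENNReal.ofReal_le_ofReal (Real.exp_le_exp.2 (neg_le_neg h))

@[simp] theorem expNeg_zero : expNeg 0 = 1 := by simp [expNeg]

theorem expNeg_ne_top (a : ℝ) : expNeg a ≠ ∞ := ENNReal.ofReal_ne_top

theorem toReal_expNeg (a : ℝ) : (expNeg a).toReal = Real.exp (-a) :=
  ENNReal.toReal_ofReal (Real.exp_pos _).le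

theorem two_mul_expNeg_le {a b c : ℝ} (h : a + b ≤ 2 * c) :
    2 * expNeg c ≤ expNeg a + expNeg b := by
  have h1 : 2 * Real.exp (-c) ≤ Real.exp (-a) + Real.exp (-b) := by
    have h2 : Real.exp (-c) ≤ Real.exp (-a / 2) * Real.exp (-b / 2) := by
      rw [← Real.exp_add, Real.exp_le_exp]; linarith
    have h3 : Real.exp (-a) = Real.exp (-a / 2) ^ 2 := by rw [← Real.exp_nat_mul]; ring_nf
    have h4 : Real.exp (-b) = Real.exp (-b / 2) ^ 2 := by rw [← Real.exp_nat_mul]; ring_nf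
    rw [h3, h4]
    nlinarith [sq_nonneg (Real.exp (-a / 2) - Real.exp (-b / 2))]
  have h5 := ENNReal.ofReal_le_ofReal h1
  rwa [ENNReal.ofReal_add (Real.exp_pos _).le (Real.exp_pos _).le,
    ENNReal.ofReal_mul zero_le_two, ENNReal.ofReal_ofNat] at h5

theorem ENNReal.two_mul_mul_le (a b : ℝ≥0∞) : 2 * (a * b) ≤ a * a + b * b := by
  rcases eq_or_ne a ∞ with rfl | ha
  · simp
  rcases eq_or_ne b ∞ with rfl | hb
  · simp
  lift a to NNReal using ha
  lift b to NNReal using hb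
  norm_cast
  rw [← NNReal.coe_le_coe]
  push_cast
  nlinarith [sq_nonneg ((a : ℝ) - b)]

/-- Division with remainder by `N` in a free abelian group of finite rank. -/
theorem exists_division (G : Type*) [AddCommGroup G] [Module.Finite ℤ G] [Module.Free ℤ G]
    (N : ℕ) [NeZero N] : ∃ rep : (Fin (Module.finrank ℤ G) → Fin N) → G,
      Function.Bijective fun p : (Fin (Module.finrank ℤ G) → Fin N) × G => rep p.1 + N • p.2 := by
  let b := Module.finBasis ℤ G
  let e := b.equivFun
  refine ⟨fun r => e.symm fun i => (r i : ℤ), ?_⟩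
  let E : (Fin (Module.finrank ℤ G) → Fin N) × G ≃ G :=
    (((Equiv.prodComm _ _).trans (Equiv.prodCongr e.toEquiv (Equiv.refl _))).trans
      (Equiv.arrowProdEquivProdArrow _ (fun _ => ℤ) (fun _ => Fin N)).symm).trans
      ((Equiv.piCongrRight fun _ => (Int.divModEquiv N).symm).trans e.symm.toEquiv)
  convert E.bijective with p
  obtain ⟨r, s⟩ := p
  apply e.injective
  ext i
  simp [E, Equiv.arrowProdEquivProdArrow]
  ring

theorem ENNReal.tsum_division {G : Type*} [AddCommGroup G] {d N : ℕ}
    {rep : (Fin d → Fin N) → G}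
    (h : Function.Bijective fun p : (Fin d → Fin N) × G => rep p.1 + N • p.2) (F : G → ℝ≥0∞) :
    ∑' x, F x = ∑ r, ∑' s, F (rep r + N • s) := by
  rw [← (Equiv.ofBijective _ h).tsum_eq, ENNReal.tsum_prod', tsum_fintype]
  rfl

/-- The rotation trick: write `y = x + r + 2t` with `r` a representative modulo 2, then put `s = x +
t`. The sum and difference of the new arguments are `r + 2s` and `r + 2t`, so the parallelogram law
will separate `s` from `t`. -/
theorem ENNReal.tsum_pairs {G : Type*} [AddCommGroup G] {d : ℕ}
    {rep : (Fin d → Fin 2) → G}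
    (h : Function.Bijective fun p : (Fin d → Fin 2) × G => rep p.1 + 2 • p.2)
    (F : G → G → ℝ≥0∞) :
    ∑' x, ∑' y, F x y = ∑ r, ∑' s, ∑' t, F (s - t) (rep r + s + t) := by
  have h1 : ∀ x, ∑' y, F x y = ∑ r, ∑' t, F x (x + (rep r + 2 • t)) := fun x => by
    rw [← (Equiv.addLeft x).tsum_eq, ENNReal.tsum_division h]
    rfl
  simp_rw [h1]
  rw [Summable.tsum_finsetSum fun _ _ => ENNReal.summable]
  refine Finset.sum_congr rfl fun r _ => ?_
  rw [ENNReal.tsum_comm]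
  conv_rhs => rw [ENNReal.tsum_comm]
  refine tsum_congr fun t => ?_
  rw [← (Equiv.subRight t).tsum_eq]
  refine tsum_congr fun s => ?_
  simp only [Equiv.subRight_apply]
  congr 1
  abel

/-! ### Theta sums of discrete subgroups -/

section Theta

variable {V : Type*} [NormedAddCommGroup V]

/-- The Gaussian sum `∑ exp (-π t ‖x + v‖²)` over the discrete subgroup `L`. -/
noncomputable def theta (L : Submodule ℤ V) (t : ℝ) (v : V) : ℝ≥0∞ :=
  ∑' x : L, expNeg (Real.pi * t * ‖(x : V) + v‖ ^ 2)

theorem one_le_theta (L : Submodule ℤ V) (t : ℝ) : 1 ≤ theta L t 0 := by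
  refine le_trans ?_ (ENNReal.le_tsum (0 : L))
  simp

theorem theta_add_mem (L : Submodule ℤ V) (t : ℝ) (v : V) {x : V} (hx : x ∈ L) :
    theta L t (x + v) = theta L t v := by
  rw [theta, theta, ← (Equiv.addRight (⟨x, hx⟩ : L)).tsum_eq
    fun y : L => expNeg (Real.pi * t * ‖(y : V) + v‖ ^ 2)]
  exact tsum_congr fun y => by simp [add_assoc]

theorem theta_sub_mem (L : Submodule ℤ V) (t : ℝ) (v : V) {x : V} (hx : x ∈ L) :
    theta L t (v - x) = theta L t v := by
  rw [sub_eq_neg_add, theta_add_mem L t v (L.neg_mem hx)]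

variable [InnerProductSpace ℝ V]

/-- Every point of the real span of `L` is within distance `r` of `L`. -/
def Covers (L : Submodule ℤ V) (r : ℝ) : Prop :=
  ∀ v ∈ Submodule.span ℝ (L : Set V), ∃ x ∈ L, ‖v - x‖ ≤ r

/-- Round every coefficient down. The family need not be independent, so short generators alone
force a small covering radius. -/
theorem covers_of_span {ι : Type*} [Fintype ι] {L : Submodule ℤ V} (b : ι → V)
    (h : Submodule.span ℤ (Set.range b) = L) : Covers L (∑ i, ‖b i‖) := by
  intro y hy
  rw [← h, Submodule.span_span_of_tower, Submodule.mem_span_range_iff_exists_fun] at hy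
  obtain ⟨c, rfl⟩ := hy
  refine ⟨∑ i, ⌊c i⌋ • b i, ?_, ?_⟩
  · refine Submodule.sum_mem _ fun i _ => Submodule.smul_mem _ _ ?_
    rw [← h]
    exact Submodule.subset_span ⟨i, rfl⟩
  · rw [← Finset.sum_sub_distrib]
    refine (norm_sum_le _ _).trans (Finset.sum_le_sum fun i _ => ?_)
    rw [← Int.cast_smul_eq_zsmul ℝ, ← sub_smul, norm_smul, Int.self_sub_floor, Real.norm_eq_abs,
      abs_of_nonneg (Int.fract_nonneg _)]
    exact mul_le_of_le_one_left (norm_nonneg _) (Int.fract_lt_one _).le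

theorem exists_covers [FiniteDimensional ℝ V] (L : Submodule ℤ V) [DiscreteTopology L] :
    ∃ r, Covers L r := by
  obtain ⟨d, b, -, h⟩ := exists_linearIndependent_span_int L
  exact ⟨_, covers_of_span b h⟩

/-- Since `exp y ≥ yᵐ / m!`, the terms with `x ≠ 0` are dominated by a multiple of `‖x‖⁻²ᵐ`, which
is summable once `2m` exceeds the rank. The origin is treated by a separate indicator term. -/
theorem summable_exp_neg_norm_sq [FiniteDimensional ℝ V] (L : Submodule ℤ V)
    [DiscreteTopology L] {a : ℝ} (ha : 0 < a) :
    Summable fun x : L => Real.exp (-(a * ‖(x : V)‖ ^ 2)) := by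
  set m := Module.finrank ℤ L + 1 with hm
  have h1 := ZLattice.summable_norm_pow_inv L (2 * m) (by omega)
  classical
  have h2 : Summable fun x : L => if x = 0 then (1 : ℝ) else 0 :=
    summable_of_hasFiniteSupport <| (Set.finite_singleton (0 : L)).subset fun x hx => by
      by_contra h
      exact hx (if_neg h)
  refine Summable.of_nonneg_of_le (fun _ => (Real.exp_pos _).le) (fun x => ?_)
    ((h1.mul_left (m.factorial / a ^ m)).add h2)
  by_cases hx : x = 0
  · subst hx
    simp [hm]
  · rw [if_neg hx, add_zero]
    have hx' : 0 < ‖x‖ := norm_pos_iff.2 hx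
    have h3 := Real.pow_div_factorial_le_exp (a * ‖x‖ ^ 2) (by positivity) m
    have h4 : ‖(x : V)‖ = ‖x‖ := rfl
    rw [Real.exp_neg, h4, inv_pow, inv_le_comm₀ (Real.exp_pos _) (by positivity)]
    refine le_trans (le_of_eq ?_) h3
    have := m.factorial_ne_zero
    field_simp
    ring

theorem theta_lt_top [FiniteDimensional ℝ V] (L : Submodule ℤ V) [DiscreteTopology L] {t : ℝ}
    (ht : 0 < t) (v : V) : theta L t v < ∞ := by
  have hp := Real.pi_pos
  have h1 := summable_exp_neg_norm_sq L (a := Real.pi * t / 2) (by positivity)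
  have h2 : theta L t v ≤ ∑' x : L, ENNReal.ofReal (Real.exp (Real.pi * t * ‖v‖ ^ 2) *
      Real.exp (-(Real.pi * t / 2 * ‖(x : V)‖ ^ 2))) := by
    refine ENNReal.tsum_le_tsum fun x => ENNReal.ofReal_le_ofReal ?_
    rw [← Real.exp_add, Real.exp_le_exp]
    have h3 : ‖(x : V)‖ ≤ ‖(x : V) + v‖ + ‖v‖ := by simpa using norm_sub_le ((x : V) + v) v
    have h4 : ‖(x : V)‖ ^ 2 ≤ 2 * ‖(x : V) + v‖ ^ 2 + 2 * ‖v‖ ^ 2 := by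
      nlinarith [sq_nonneg (‖(x : V) + v‖ - ‖v‖), norm_nonneg (x : V)]
    have h5 := mul_le_mul_of_nonneg_left h4 (by positivity : 0 ≤ Real.pi * t / 2)
    linarith
  refine h2.trans_lt ?_
  rw [← ENNReal.ofReal_tsum_of_nonneg (fun _ => by positivity) (h1.mul_left _)]
  exact ENNReal.ofReal_lt_top

theorem norm_add_sq_add_norm_sub_sq (x y : V) :
    ‖x + y‖ ^ 2 + ‖x - y‖ ^ 2 = 2 * (‖x‖ ^ 2 + ‖y‖ ^ 2) := by
  have := parallelogram_law_with_norm ℝ x y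
  linarith

/-- By the symmetry of `L` the sum is the same at `v` and `-v`. The two Gaussians at `x + v` and `x
- v` have mean at least their geometric mean, which by the parallelogram law is the Gaussian at `x`
times that at `v`. -/
theorem expNeg_mul_theta_le (L : Submodule ℤ V) (t : ℝ) (v : V) :
    expNeg (Real.pi * t * ‖v‖ ^ 2) * theta L t 0 ≤ theta L t v := by
  have h1 : theta L t v = ∑' x : L, expNeg (Real.pi * t * ‖(x : V) - v‖ ^ 2) := by
    rw [theta, ← (Equiv.neg L).tsum_eq]
    refine tsum_congr fun x => ?_
    rw [← norm_neg]
    simp [sub_eq_add_neg, add_comm]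
  have h2 : 2 * (expNeg (Real.pi * t * ‖v‖ ^ 2) * theta L t 0) ≤ 2 * theta L t v := by
    conv_rhs => rw [two_mul]
    nth_rw 2 [h1]
    rw [theta, theta, ← ENNReal.tsum_add, ← ENNReal.tsum_mul_left, ← ENNReal.tsum_mul_left]
    refine ENNReal.tsum_le_tsum fun x => ?_
    rw [← expNeg_add]
    refine two_mul_expNeg_le (le_of_eq ?_)
    have := norm_add_sq_add_norm_sub_sq (x : V) v
    rw [add_zero]
    linear_combination Real.pi * t * this
  exact (ENNReal.mul_le_mul_iff_right two_ne_zero ENNReal.ofNat_ne_top).1 h2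

/-- With `P r z` the Gaussian sum over the class `r + 2L` shifted by `z`, the three products of
theta sums are the sums over `r` of `P r (2v) * P r 0`, `(P r (2v))²` and `(P r 0)²`. -/
theorem two_mul_theta_mul_theta_le [FiniteDimensional ℝ V] (L : Submodule ℤ V)
    [DiscreteTopology L] (t : ℝ) (v : V) :
    2 * (theta L t v * theta L t v) ≤
      theta L t (v + v) * theta L t 0 + theta L t 0 * theta L t 0 := by
  obtain ⟨rep, hrep⟩ := exists_division L 2
  let P (r : Fin (Module.finrank ℤ L) → Fin 2) (z : V) : ℝ≥0∞ :=
    ∑' s : L, expNeg (Real.pi * t / 2 * ‖(rep r : V) + 2 • (s : V) + z‖ ^ 2)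
  have key (y z : V) : theta L t y * theta L t z = ∑ r, P r (y + z) * P r (z - y) := by
    simp only [theta, P, ← ENNReal.tsum_mul_left, ← ENNReal.tsum_mul_right]
    rw [ENNReal.tsum_comm, ENNReal.tsum_pairs hrep]
    refine Finset.sum_congr rfl fun r _ => ?_
    rw [ENNReal.tsum_comm]
    refine tsum_congr fun b => tsum_congr fun a => ?_
    rw [← expNeg_add, ← expNeg_add]
    congr 1
    have := norm_add_sq_add_norm_sub_sq ((rep r : V) + a + b + z) ((a - b : V) + y)
    have e1 : (rep r : V) + a + b + z + ((a - b : V) + y) = rep r + 2 • (a : V) + (y + z) := by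
      rw [two_smul]; abel
    have e2 : (rep r : V) + a + b + z - ((a - b : V) + y) = rep r + 2 • (b : V) + (z - y) := by
      rw [two_smul]; abel
    rw [e1, e2] at this
    push_cast
    linear_combination (-Real.pi * t / 2) * this
  have h1 := key v v
  have h2 := key 0 (v + v)
  have h3 := key 0 0
  simp only [sub_self, sub_zero, zero_add] at h1 h2 h3
  rw [h1, mul_comm (theta L t (v + v)), h2, h3, ← Finset.sum_add_distrib, Finset.mul_sum]
  exact Finset.sum_le_sum fun r _ => ENNReal.two_mul_mul_le _ _

/-- If `m` is the supremum over the real span and `g0` the value at 0, the doubling inequality gives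
`2m² ≤ m g0 + g0²`, hence `m ≤ g0`. The span is stable under doubling, and periodicity makes `m`
finite. -/
theorem theta_le [FiniteDimensional ℝ V] (L : Submodule ℤ V) [DiscreteTopology L] {t : ℝ}
    (ht : 0 < t) {v : V} (hv : v ∈ Submodule.span ℝ (L : Set V)) :
    theta L t v ≤ theta L t 0 := by
  have hp := Real.pi_pos
  obtain ⟨r, hr⟩ := exists_covers L
  set g : Submodule.span ℝ (L : Set V) → ℝ := fun v => (theta L t v).toReal with hg
  set g0 := (theta L t 0).toReal with hg0
  have hfin (v : V) : theta L t v ≠ ∞ := (theta_lt_top L ht v).ne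
  have h0 : 1 ≤ g0 := by
    simpa using ENNReal.toReal_mono (hfin 0) (one_le_theta L t)
  have hbdd : BddAbove (Set.range g) := by
    -- After a lattice translation the shift `w` has norm at most `r`, and `‖y‖² ≤ 2‖y + w‖² + 2r²`;
    -- halving `t` absorbs the factor 2.
    refine ⟨(expNeg (-(Real.pi * t * r ^ 2)) * theta L (t / 2) 0).toReal, ?_⟩
    rintro _ ⟨⟨v, hv⟩, rfl⟩
    refine ENNReal.toReal_mono (ENNReal.mul_ne_top (expNeg_ne_top _)
      (theta_lt_top L (by positivity) _).ne) ?_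
    obtain ⟨x, hx, hxr⟩ := hr v hv
    change theta L t v ≤ _
    rw [← theta_sub_mem L t v hx, theta, theta, ← ENNReal.tsum_mul_left]
    refine ENNReal.tsum_le_tsum fun y => ?_
    rw [← expNeg_add]
    refine expNeg_le_expNeg ?_
    rw [add_zero]
    have h3 : ‖(y : V)‖ ≤ ‖(y : V) + (v - x)‖ + ‖v - x‖ := by
      simpa using norm_sub_le ((y : V) + (v - x)) (v - x)
    have h4 : ‖(y : V)‖ ^ 2 ≤ 2 * ‖(y : V) + (v - x)‖ ^ 2 + 2 * r ^ 2 := by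
      nlinarith [sq_nonneg (‖(y : V) + (v - x)‖ - ‖v - x‖), norm_nonneg (y : V),
        norm_nonneg (v - x)]
    have h5 := mul_le_mul_of_nonneg_left h4 (by positivity : 0 ≤ Real.pi * t / 2)
    linarith
  have hstep (v : Submodule.span ℝ (L : Set V)) : 2 * (g v * g v) ≤ (⨆ x, g x) * g0 + g0 * g0 := by
    have h1 := ENNReal.toReal_mono (ENNReal.add_ne_top.2 ⟨ENNReal.mul_ne_top (hfin _) (hfin _),
      ENNReal.mul_ne_top (hfin _) (hfin _)⟩) (two_mul_theta_mul_theta_le L t (v : V))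
    rw [ENNReal.toReal_add (ENNReal.mul_ne_top (hfin _) (hfin _))
      (ENNReal.mul_ne_top (hfin _) (hfin _)), ENNReal.toReal_mul, ENNReal.toReal_mul,
      ENNReal.toReal_mul, ENNReal.toReal_mul] at h1
    have h2 : g (v + v) ≤ ⨆ x, g x := le_ciSup hbdd _
    refine le_trans h1 ?_
    gcongr
    exact h2
  set m := ⨆ x, g x with hm
  have hm0 : g0 ≤ m := le_ciSup hbdd 0
  have h6 : m ≤ √((m * g0 + g0 * g0) / 2) :=
    ciSup_le fun v => Real.le_sqrt_of_sq_le (by have := hstep v; nlinarith)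
  have h7 : m ^ 2 ≤ (m * g0 + g0 * g0) / 2 := by
    have : 0 ≤ (m * g0 + g0 * g0) / 2 := by nlinarith
    rwa [Real.le_sqrt (by linarith) this] at h6
  -- The quadratic inequality factors as `(2m + g0)(m - g0) ≤ 0`, with `g0 ≥ 1`.
  have h8 : m ≤ g0 := by nlinarith
  exact (ENNReal.toReal_le_toReal (hfin _) (hfin _)).1 ((le_ciSup hbdd ⟨v, hv⟩).trans h8)

theorem le_theta_of_covers {L : Submodule ℤ V} {r : ℝ} (hr : Covers L r) {t : ℝ} (ht : 0 ≤ t)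
    {v : V} (hv : v ∈ Submodule.span ℝ (L : Set V)) :
    expNeg (Real.pi * t * r ^ 2) * theta L t 0 ≤ theta L t v := by
  obtain ⟨x, hx, hxr⟩ := hr v hv
  have hp := Real.pi_pos
  rw [← theta_sub_mem L t v hx]
  refine le_trans ?_ (expNeg_mul_theta_le L t (v - x))
  gcongr
  exact expNeg_le_expNeg (by gcongr)

/-- The theta sum of `L` decomposed over the classes modulo `N L`. -/
theorem theta_eq_sum_division {L : Submodule ℤ V} {d N : ℕ} [NeZero N]
    {rep : (Fin d → Fin N) → L}
    (h : Function.Bijective fun p : (Fin d → Fin N) × L => rep p.1 + N • p.2) (t : ℝ) :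
    theta L t 0 = ∑ r, theta L ((N : ℝ) ^ 2 * t) ((N : ℝ)⁻¹ • (rep r : V)) := by
  have hN : (N : ℝ) ≠ 0 := Nat.cast_ne_zero.2 (NeZero.ne N)
  rw [theta, ENNReal.tsum_division h]
  refine Finset.sum_congr rfl fun r _ => tsum_congr fun s => ?_
  congr 1
  have : ((rep r + N • s : L) : V) + 0 = (N : ℝ) • ((s : V) + (N : ℝ)⁻¹ • (rep r : V)) := by
    rw [smul_add, smul_inv_smul₀ hN, add_zero, add_comm]
    push_cast
    rw [Nat.cast_smul_eq_nsmul]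
  rw [this, norm_smul, mul_pow, Real.norm_natCast]
  ring

/-- Each of the `N ^ rank` classes modulo `N L` contributes a translate of the sum for `N L`, and
the translate at 0 is the largest. -/
theorem theta_le_pow_mul [FiniteDimensional ℝ V] (L : Submodule ℤ V) [DiscreteTopology L]
    {t : ℝ} (ht : 0 < t) (N : ℕ) [NeZero N] :
    theta L t 0 ≤ (N : ℝ≥0∞) ^ Module.finrank ℤ L * theta L ((N : ℝ) ^ 2 * t) 0 := by
  obtain ⟨rep, h⟩ := exists_division L N
  have hN : (0 : ℝ) < N := Nat.cast_pos.2 (NeZero.pos N)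
  rw [theta_eq_sum_division h]
  refine (Finset.sum_le_card_nsmul _ _ (theta L ((N : ℝ) ^ 2 * t) 0) fun r _ =>
    theta_le L (by positivity) ?_).trans ?_
  · exact Submodule.smul_mem _ _ (Submodule.subset_span (rep r).2)
  · simp

theorem pow_mul_le_theta [FiniteDimensional ℝ V] (L : Submodule ℤ V) [DiscreteTopology L]
    {t : ℝ} (ht : 0 < t) (N : ℕ) [NeZero N] {ρ : ℝ} (hρ : Covers L ρ) :
    expNeg (Real.pi * ((N : ℝ) ^ 2 * t) * ρ ^ 2) *
      ((N : ℝ≥0∞) ^ Module.finrank ℤ L * theta L ((N : ℝ) ^ 2 * t) 0) ≤ theta L t 0 := by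
  obtain ⟨rep, h⟩ := exists_division L N
  rw [theta_eq_sum_division h t]
  refine le_trans (le_of_eq ?_) (Finset.card_nsmul_le_sum Finset.univ _
    (expNeg (Real.pi * ((N : ℝ) ^ 2 * t) * ρ ^ 2) * theta L ((N : ℝ) ^ 2 * t) 0) fun r _ =>
      le_theta_of_covers hρ (by positivity) ?_)
  · simp
    ring
  · exact Submodule.smul_mem _ _ (Submodule.subset_span (rep r).2)

end Theta

/-! ### Positive correlation of subgroups under Gaussian weights -/

open Classical in
theorem ENNReal.tsum_mul_comp_eq {S X : Type*} (E : S → X) (W : S → ℝ≥0∞) (F : X → ℝ≥0∞) :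
    ∑' s, W s * F (E s) = ∑' x, F x * ∑' s, if E s = x then W s else 0 := by
  simp_rw [← ENNReal.tsum_mul_left]
  rw [ENNReal.tsum_comm]
  refine tsum_congr fun s => ?_
  rw [tsum_eq_single (E s) fun x hx => by rw [if_neg hx.symm, mul_zero], if_pos rfl, mul_comm]

-- Let `P x` be the mass of the fibre of `E` over `x`. The two sides are `∑ P (τ x) P x` and `∑ (P
-- x)²`, so this is `2ab ≤ a² + b²` combined with the invariance of the second sum under `τ`.
open Classical in
theorem ENNReal.tsum_fiber_le {S X : Type*} (E : S → X) (τ : X ≃ X) (W : S → ℝ≥0∞) :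
    ∑' s, ∑' t, (if E s = τ (E t) then W s * W t else 0) ≤
      ∑' s, ∑' t, (if E s = E t then W s * W t else 0) := by
  set P : X → ℝ≥0∞ := fun x => ∑' s, if E s = x then W s else 0 with hP
  have key (σ : X ≃ X) : ∑' s, ∑' t, (if E s = σ (E t) then W s * W t else 0) =
      ∑' x, P (σ x) * P x := by
    rw [ENNReal.tsum_comm, ← ENNReal.tsum_mul_comp_eq E W fun x => P (σ x)]
    refine tsum_congr fun t => ?_
    rw [← ENNReal.tsum_mul_left]
    refine tsum_congr fun s => ?_
    split_ifs
    · exact mul_comm _ _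
    · rw [mul_zero]
  refine (key τ).le.trans (le_trans ?_ (key (Equiv.refl X)).ge)
  rw [← ENNReal.mul_le_mul_iff_right two_ne_zero ENNReal.ofNat_ne_top, ← ENNReal.tsum_mul_left]
  refine (ENNReal.tsum_le_tsum fun x => ENNReal.two_mul_mul_le _ _).trans ?_
  rw [ENNReal.tsum_add, τ.tsum_eq fun x => P x * P x, two_mul]
  exact le_rfl

open Classical in
/-- Subgroups of a free abelian group are positively correlated for a Gaussian weight. -/
theorem tsum_mul_tsum_le_of_parallelogram {G : Type*} [AddCommGroup G] [Module.Finite ℤ G]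
    [Module.Free ℤ G] (Q : G → ℝ) (hQ : ∀ x y, Q (x + y) + Q (x - y) = 2 * (Q x + Q y))
    (M N : AddSubgroup G) :
    (∑' x, if x ∈ M then expNeg (Q x) else 0) * (∑' x, if x ∈ N then expNeg (Q x) else 0) ≤
      (∑' x, if x ∈ M ∧ x ∈ N then expNeg (Q x) else 0) * ∑' x, expNeg (Q x) := by
  obtain ⟨rep, hrep⟩ := exists_division G 2
  have hsplit (r) (s t : G) : expNeg (Q (s - t)) * expNeg (Q (rep r + s + t)) =
      expNeg (Q (rep r + 2 • s) / 2) * expNeg (Q (rep r + 2 • t) / 2) := by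
    rw [← expNeg_add, ← expNeg_add]
    congr 1
    have := hQ (rep r + s + t) (s - t)
    rw [show rep r + s + t + (s - t) = rep r + 2 • s by rw [two_smul]; abel,
      show rep r + s + t - (s - t) = rep r + 2 • t by rw [two_smul]; abel] at this
    linarith
  simp only [← ENNReal.tsum_mul_left, ← ENNReal.tsum_mul_right]
  rw [ENNReal.tsum_comm, ENNReal.tsum_pairs hrep]
  rw [ENNReal.tsum_comm, ENNReal.tsum_pairs hrep]
  refine Finset.sum_le_sum fun r _ => ?_
  -- In the rotated coordinates `x ∈ M` says `s ≡ t` modulo `M`, while `y ∈ N` says `s ≡ -r - t`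
  -- modulo `N`. Hence the left side counts pairs whose classes differ by `τ`, and the right side
  -- pairs with equal classes.
  let τ : (G ⧸ M) × (G ⧸ N) ≃ (G ⧸ M) × (G ⧸ N) :=
    (Equiv.refl _).prodCongr (Equiv.subLeft (-(rep r : G ⧸ N)))
  have h := ENNReal.tsum_fiber_le (fun s : G => ((s : G ⧸ M), (s : G ⧸ N))) τ
    fun s => expNeg (Q (rep r + 2 • s) / 2)
  refine le_trans (le_of_eq ?_) (h.trans (le_of_eq ?_))
  · refine tsum_congr fun s => tsum_congr fun t => ?_
    have e1 : ((s : G ⧸ M) = t) ↔ s - t ∈ M := by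
      rw [← sub_eq_zero, ← QuotientAddGroup.mk_sub, QuotientAddGroup.eq_zero_iff]
    have e2 : ((s : G ⧸ N) = -(rep r : G ⧸ N) - t) ↔ rep r + s + t ∈ N := by
      rw [← sub_eq_zero, ← QuotientAddGroup.eq_zero_iff]
      rw [show (s : G ⧸ N) - (-(rep r : G ⧸ N) - t) = rep r + s + t by abel,
        QuotientAddGroup.mk_add, QuotientAddGroup.mk_add]
    simp only [τ, Equiv.prodCongr_apply, Prod.map, Equiv.refl_apply, Equiv.subLeft_apply,
      Prod.mk.injEq, e1, e2]
    by_cases h1 : s - t ∈ M <;> by_cases h2 : rep r + s + t ∈ N <;> simp [h1, h2, hsplit]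
  · refine tsum_congr fun s => tsum_congr fun t => ?_
    have e1 (K : AddSubgroup G) : ((s : G ⧸ K) = t) ↔ s - t ∈ K := by
      rw [← sub_eq_zero, ← QuotientAddGroup.mk_sub, QuotientAddGroup.eq_zero_iff]
    simp only [Prod.mk.injEq, e1, ite_mul, zero_mul, hsplit]

open Classical in
theorem ENNReal.tsum_subtype_of_le {V : Type*} [NormedAddCommGroup V] {K L : Submodule ℤ V} (h : K ≤ L) (F : V → ℝ≥0∞) :
    ∑' x : K, F x = ∑' x : L, if (x : V) ∈ K then F x else 0 := by
  have h1 := tsum_subtype (K : Set V) F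
  have h2 := tsum_subtype (L : Set V) fun x => if x ∈ K then F x else 0
  refine h1.trans (Eq.trans (tsum_congr fun x => ?_) h2.symm)
  by_cases hx : x ∈ K
  · simp [hx, h hx]
  · by_cases hx' : x ∈ L <;> simp [hx, hx']

theorem toReal_theta {V : Type*} [NormedAddCommGroup V] (L : Submodule ℤ V) (t : ℝ) :
    (theta L t 0).toReal = ∑' x : L, Real.exp (-(Real.pi * t * ‖(x : V)‖ ^ 2)) := by
  rw [theta, ENNReal.tsum_toReal_eq fun _ => expNeg_ne_top _]
  simp [toReal_expNeg]

/-! ### Gaussian sums along a contraction -/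

section

variable {V : Type*} [NormedAddCommGroup V] [InnerProductSpace ℝ V] [FiniteDimensional ℝ V]

theorem tendsto_toReal_theta_one (L : Submodule ℤ V) [DiscreteTopology L] :
    Tendsto (fun t => (theta L t 0).toReal) (𝓝[<] 1) (𝓝 (theta L 1 0).toReal) := by
  have hp := Real.pi_pos
  simp only [toReal_theta]
  refine tendsto_tsum_of_dominated_convergence
    (summable_exp_neg_norm_sq L (a := Real.pi * (1 / 2)) (by positivity)) (fun x => ?_) ?_
  · refine Tendsto.mono_left ?_ nhdsWithin_le_nhds
    exact Continuous.tendsto (by fun_prop) 1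
  · have : Set.Ioi (1 / 2 : ℝ) ∈ 𝓝[<] (1 : ℝ) :=
      mem_nhdsWithin_of_mem_nhds (Ioi_mem_nhds (by norm_num))
    filter_upwards [this] with t ht x
    rw [Real.norm_of_nonneg (Real.exp_pos _).le, Real.exp_le_exp]
    have ht' : (1 / 2 : ℝ) ≤ t := ht.le
    exact neg_le_neg (by gcongr)

variable {W : Type*} [NormedAddCommGroup W] [InnerProductSpace ℝ W] [FiniteDimensional ℝ W]

-- Positive correlation in `A × B` of the graph of `f` and of `A × K`. The quadratic form is chosen
-- so that its restriction to the graph is the Gaussian weight of `A`, while on the whole product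
-- the mass `Z` of the first factor splits off and cancels.
open Classical in
theorem theta_mul_theta_le_of_contraction (A A₀ : Submodule ℤ V) [DiscreteTopology A]
    (B K : Submodule ℤ W) [DiscreteTopology B] (f : A →+ B) (hf : ∀ x, ‖(f x : W)‖ ≤ ‖(x : V)‖)
    (hA : A₀ ≤ A) (hK : K ≤ B) (h : ∀ x : A, (x : V) ∈ A₀ ↔ (f x : W) ∈ K) {t : ℝ} (ht : 0 < t)
    (ht1 : t < 1) : theta A 1 0 * theta K t 0 ≤ theta A₀ 1 0 * theta B t 0 := by
  have hp := Real.pi_pos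
  let q (x : A) : ℝ := Real.pi * (‖(x : V)‖ ^ 2 - t * ‖(f x : W)‖ ^ 2)
  let Q (z : A × B) : ℝ := q z.1 + Real.pi * t * ‖(z.2 : W)‖ ^ 2
  have hQ (x y : A × B) : Q (x + y) + Q (x - y) = 2 * (Q x + Q y) := by
    have h1 := norm_add_sq_add_norm_sub_sq (x.1 : V) y.1
    have h2 := norm_add_sq_add_norm_sub_sq (f x.1 : W) (f y.1)
    have h3 := norm_add_sq_add_norm_sub_sq (x.2 : W) y.2
    simp only [Q, q, Prod.fst_add, Prod.snd_add, Prod.fst_sub, Prod.snd_sub, map_add, map_sub,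
      Submodule.coe_add, Submodule.coe_sub]
    linear_combination Real.pi * h1 - Real.pi * t * h2 + Real.pi * t * h3
  let M : AddSubgroup (A × B) := f.graph
  let N : AddSubgroup (A × B) := (K.toAddSubgroup.comap B.subtype.toAddMonoidHom).comap
    (AddMonoidHom.snd A B)
  have hM (z : A × B) : z ∈ M ↔ z.2 = f z.1 := by
    rw [AddMonoidHom.mem_graph, eq_comm]
  have hN (z : A × B) : z ∈ N ↔ (z.2 : W) ∈ K := Iff.rfl
  have key := tsum_mul_tsum_le_of_parallelogram Q hQ M N
  simp only [hM, hN, ENNReal.tsum_prod'] at key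
  set Z := ∑' x : A, expNeg (q x) with hZ
  have hZ0 : Z ≠ 0 := by
    refine ne_of_gt (lt_of_lt_of_le ?_ (ENNReal.le_tsum (0 : A)))
    simp [q]
  -- This needs `t < 1`: since `f` is a contraction, `q x ≥ π (1 - t) ‖x‖²`. At `t = 1` the form may
  -- be degenerate.
  have hZt : Z ≠ ∞ := by
    refine ne_of_lt (lt_of_le_of_lt ?_ (theta_lt_top A (sub_pos.2 ht1) 0))
    refine ENNReal.tsum_le_tsum fun x => expNeg_le_expNeg ?_
    have h1 : ‖(f x : W)‖ ^ 2 ≤ ‖(x : V)‖ ^ 2 := by have := hf x; gcongr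
    simp only [q, add_zero, mul_assoc]
    gcongr
    nlinarith
  have s1 : ∑' x : A, ∑' y : B, (if y = f x then expNeg (Q (x, y)) else 0) = theta A 1 0 := by
    refine tsum_congr fun x => ?_
    rw [tsum_ite_eq]
    simp only [Q, q, add_zero]
    congr 1
    ring
  have s2 : ∑' x : A, ∑' y : B, (if (y : W) ∈ K then expNeg (Q (x, y)) else 0) =
      Z * theta K t 0 := by
    rw [hZ, ← ENNReal.tsum_mul_right]
    refine tsum_congr fun x => ?_
    rw [theta, ENNReal.tsum_subtype_of_le hK fun y => expNeg (Real.pi * t * ‖y + 0‖ ^ 2),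
      ← ENNReal.tsum_mul_left]
    refine tsum_congr fun y => ?_
    simp only [Q, expNeg_add, add_zero, mul_ite, mul_zero]
  have s3 : ∑' x : A, ∑' y : B, (if y = f x ∧ (y : W) ∈ K then expNeg (Q (x, y)) else 0) =
      theta A₀ 1 0 := by
    rw [theta, ENNReal.tsum_subtype_of_le hA fun y => expNeg (Real.pi * 1 * ‖y + 0‖ ^ 2)]
    refine tsum_congr fun x => ?_
    rw [tsum_eq_single (f x) fun y hy => if_neg fun h => hy h.1]
    simp only [h, true_and, Q, q, add_zero]
    congr 2
    ring
  have s4 : ∑' x : A, ∑' y : B, expNeg (Q (x, y)) = Z * theta B t 0 := by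
    rw [hZ, ← ENNReal.tsum_mul_right]
    refine tsum_congr fun x => ?_
    rw [theta, ← ENNReal.tsum_mul_left]
    refine tsum_congr fun y => ?_
    simp only [Q, expNeg_add, add_zero]
  rw [s1, s2, s3, s4, mul_left_comm, mul_left_comm (theta A₀ 1 0)] at key
  exact (ENNReal.mul_le_mul_iff_right hZ0 hZt).1 key

end

/-! ### Real theta sums -/

section

variable {V : Type*} [NormedAddCommGroup V] [InnerProductSpace ℝ V] [FiniteDimensional ℝ V]

/-- The logarithm of the Gaussian sum `∑ exp (-π t ‖x‖²)` over `L`. -/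
noncomputable def logTheta (L : Submodule ℤ V) (t : ℝ) : ℝ := Real.log (theta L t 0).toReal

theorem one_le_toReal_theta (L : Submodule ℤ V) [DiscreteTopology L] {t : ℝ} (ht : 0 < t) :
    1 ≤ (theta L t 0).toReal := by
  simpa using ENNReal.toReal_mono (theta_lt_top L ht 0).ne (one_le_theta L t)

theorem logTheta_nonneg (L : Submodule ℤ V) [DiscreteTopology L] {t : ℝ} (ht : 0 < t) :
    0 ≤ logTheta L t := Real.log_nonneg (one_le_toReal_theta L ht)

theorem theta_eq_expNeg_logTheta (L : Submodule ℤ V) [DiscreteTopology L] {t : ℝ} (ht : 0 < t) :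
    theta L t 0 = expNeg (-logTheta L t) := by
  have h := one_le_toReal_theta L ht
  rw [expNeg, neg_neg, logTheta, Real.exp_log (by linarith),
    ENNReal.ofReal_toReal (theta_lt_top L ht 0).ne]

theorem expNeg_le_expNeg_iff {a b : ℝ} : expNeg a ≤ expNeg b ↔ b ≤ a := by
  rw [expNeg, expNeg, ENNReal.ofReal_le_ofReal_iff (Real.exp_pos _).le, Real.exp_le_exp,
    neg_le_neg_iff]

theorem natCast_eq_expNeg {n : ℕ} (hn : n ≠ 0) : (n : ℝ≥0∞) = expNeg (-Real.log n) := by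
  rw [expNeg, neg_neg, Real.exp_log (by positivity), ENNReal.ofReal_natCast]

theorem natCast_pow_eq_expNeg {n : ℕ} (hn : n ≠ 0) (d : ℕ) :
    (n : ℝ≥0∞) ^ d = expNeg (-(d * Real.log n)) := by
  rw [← Nat.cast_pow, natCast_eq_expNeg (pow_ne_zero d hn)]
  push_cast
  rw [Real.log_pow]

theorem logTheta_le (L : Submodule ℤ V) [DiscreteTopology L] {t : ℝ} (ht : 0 < t) (N : ℕ)
    [NeZero N] :
    logTheta L t ≤ Module.finrank ℤ L * Real.log N + logTheta L ((N : ℝ) ^ 2 * t) := by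
  have hN : (0 : ℝ) < N := Nat.cast_pos.2 (NeZero.pos N)
  have h := theta_le_pow_mul L ht N
  rw [theta_eq_expNeg_logTheta L ht, theta_eq_expNeg_logTheta L (by positivity),
    natCast_pow_eq_expNeg (NeZero.ne N), ← expNeg_add, expNeg_le_expNeg_iff] at h
  linarith

theorem le_logTheta (L : Submodule ℤ V) [DiscreteTopology L] {t : ℝ} (ht : 0 < t) (N : ℕ)
    [NeZero N] {r : ℝ} (hr : Covers L r) :
    Module.finrank ℤ L * Real.log N + logTheta L ((N : ℝ) ^ 2 * t) -
      Real.pi * ((N : ℝ) ^ 2 * t) * r ^ 2 ≤ logTheta L t := by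
  have hN : (0 : ℝ) < N := Nat.cast_pos.2 (NeZero.pos N)
  have h := pow_mul_le_theta L ht N hr
  rw [theta_eq_expNeg_logTheta L ht, theta_eq_expNeg_logTheta L (by positivity),
    natCast_pow_eq_expNeg (NeZero.ne N), ← expNeg_add, ← expNeg_add, expNeg_le_expNeg_iff] at h
  linarith

/-! ### The logarithm of the covolume as a limit of Gaussian sums -/

/-- Minus the logarithm of the covolume of `L`, approximated by the scaling `2 ^ (-k) L`. -/
noncomputable def logDensityApprox (L : Submodule ℤ V) (k : ℕ) : ℝ :=
  logTheta L ((4 : ℝ)⁻¹ ^ k) - k * (Module.finrank ℤ L * Real.log 2)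

/-- Minus the logarithm of the covolume of `L`. -/
noncomputable def logDensity (L : Submodule ℤ V) : ℝ := ⨅ k, logDensityApprox L k

theorem logDensityApprox_le (L : Submodule ℤ V) [DiscreteTopology L] (k : ℕ) :
    logDensityApprox L k ≤ logTheta L 1 := by
  have h := logTheta_le L (t := (4 : ℝ)⁻¹ ^ k) (by positivity) (2 ^ k)
  have e : (((2 ^ k : ℕ) : ℝ)) ^ 2 * (4 : ℝ)⁻¹ ^ k = 1 := by
    rw [Nat.cast_pow, ← pow_mul, mul_comm k 2, pow_mul, ← mul_pow]
    norm_num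
  rw [e, Nat.cast_pow, Real.log_pow] at h
  rw [logDensityApprox]
  push_cast at h
  linarith

/-- The loss `π r²` does not depend on `k`, because `N² t = 1` for `N = 2ᵏ` and `t = 4⁻ᵏ`. This
makes the limit finite and later bounds `h¹`. -/
theorem le_logDensityApprox (L : Submodule ℤ V) [DiscreteTopology L] {r : ℝ} (hr : Covers L r)
    (k : ℕ) : logTheta L 1 - Real.pi * r ^ 2 ≤ logDensityApprox L k := by
  have h := le_logTheta L (t := (4 : ℝ)⁻¹ ^ k) (by positivity) (2 ^ k) hr
  have e : (((2 ^ k : ℕ) : ℝ)) ^ 2 * (4 : ℝ)⁻¹ ^ k = 1 := by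
    rw [Nat.cast_pow, ← pow_mul, mul_comm k 2, pow_mul, ← mul_pow]
    norm_num
  rw [e, Nat.cast_pow, Real.log_pow] at h
  rw [logDensityApprox]
  push_cast at h
  linarith

theorem antitone_logDensityApprox (L : Submodule ℤ V) [DiscreteTopology L] :
    Antitone (logDensityApprox L) := by
  refine antitone_nat_of_succ_le fun k => ?_
  have h := logTheta_le L (t := (4 : ℝ)⁻¹ ^ (k + 1)) (by positivity) 2
  have e : ((2 : ℕ) : ℝ) ^ 2 * (4 : ℝ)⁻¹ ^ (k + 1) = (4 : ℝ)⁻¹ ^ k := by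
    rw [pow_succ]
    push_cast
    ring
  rw [e] at h
  rw [logDensityApprox, logDensityApprox]
  push_cast at h ⊢
  linarith

theorem bddBelow_logDensityApprox (L : Submodule ℤ V) [DiscreteTopology L] :
    BddBelow (Set.range (logDensityApprox L)) := by
  obtain ⟨r, hr⟩ := exists_covers L
  exact ⟨_, Set.forall_mem_range.2 (le_logDensityApprox L hr)⟩

theorem tendsto_logDensityApprox (L : Submodule ℤ V) [DiscreteTopology L] :
    Tendsto (logDensityApprox L) atTop (𝓝 (logDensity L)) :=
  tendsto_atTop_ciInf (antitone_logDensityApprox L) (bddBelow_logDensityApprox L)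

theorem logDensity_le (L : Submodule ℤ V) [DiscreteTopology L] :
    logDensity L ≤ logTheta L 1 :=
  (ciInf_le (bddBelow_logDensityApprox L) 0).trans (logDensityApprox_le L 0)

theorem le_logDensity (L : Submodule ℤ V) [DiscreteTopology L] {r : ℝ} (hr : Covers L r) :
    logTheta L 1 - Real.pi * r ^ 2 ≤ logDensity L :=
  le_ciInf (le_logDensityApprox L hr)

end

/-! ### Concrete description of short exact sequences of lattices -/

namespace EucLat

/-- The image of a lattice morphism, as a subgroup of the ambient space of the target. -/
def image {A B : EucLat.{u}} (f : A ⟶ B) : Submodule ℤ B.V :=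
  LinearMap.range (B.carrier.subtype ∘ₗ f.toFun.toIntLinearMap)

theorem apply_mem_image {A B : EucLat.{u}} (f : A ⟶ B) (x : A.carrier) :
    (f.toFun x : B.V) ∈ image f := ⟨x, rfl⟩

theorem image_le {A B : EucLat.{u}} (f : A ⟶ B) : image f ≤ B.carrier := by
  rintro _ ⟨x, rfl⟩
  exact (f.toFun x).2

theorem discreteTopology_of_le {B : EucLat.{u}} {K : Submodule ℤ B.V} (hK : K ≤ B.carrier) :
    DiscreteTopology K :=
  DiscreteTopology.of_subset (s := (B.carrier : Set B.V)) B.discrete hK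

/-- `g` is the quotient of `B` by `K`: it is surjective and the norm of `g y` is the distance of
`y` to the real span of `K`. -/
structure IsQuotient {B C : EucLat.{u}} (K : Submodule ℤ B.V) (g : B ⟶ C) : Prop where
  surj : Function.Surjective g.toFun
  norm_eq : ∀ y : B.carrier, ∃ q ∈ Submodule.span ℝ (K : Set B.V), (∀ x ∈ K, inner ℝ ((y : B.V) - q) x = 0) ∧
    ‖(g.toFun y : C.V)‖ = ‖(y : B.V) - q‖

/-- `0 ⟶ A ⟶ B ⟶ C ⟶ 0` is exact for the underlying groups, `A` carries the norm induced from
`B` and `C` the quotient norm. -/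
structure IsConcreteExact {A B C : EucLat.{u}} (f : A ⟶ B) (g : B ⟶ C) : Prop where
  norm_left : ∀ x, ‖(f.toFun x : B.V)‖ = ‖(x : A.V)‖
  exact : ∀ y, g.toFun y = 0 ↔ (y : B.V) ∈ image f
  quotient : IsQuotient (image f) g

theorem inner_eq_zero_of_mem_span {V : Type*} [NormedAddCommGroup V] [InnerProductSpace ℝ V]
    {K : Submodule ℤ V} {y : V} (h : ∀ x ∈ K, inner ℝ y x = 0) {z : V}
    (hz : z ∈ Submodule.span ℝ (K : Set V)) : inner ℝ y z = 0 := by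
  have h1 : Submodule.span ℝ (K : Set V) ≤ LinearMap.ker (innerₛₗ ℝ y) :=
    Submodule.span_le.2 h
  exact h1 hz

/-- A contraction vanishing on `K` factors through the orthogonal projection even though `K` is only
discrete: subtract from `n y` a point of `K` within bounded distance of `n q`, apply the contraction
bound, and let `n` grow. -/
theorem norm_apply_le_of_vanishing {B D : EucLat.{u}} {K : Submodule ℤ B.V} (hK : K ≤ B.carrier)
    (h : B ⟶ D) (hh : ∀ y : B.carrier, (y : B.V) ∈ K → h.toFun y = 0) (y : B.carrier) {q : B.V}
    (hq : q ∈ Submodule.span ℝ (K : Set B.V)) (hy : ∀ x ∈ K, inner ℝ ((y : B.V) - q) x = 0) :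
    ‖(h.toFun y : D.V)‖ ≤ ‖(y : B.V) - q‖ := by
  have := discreteTopology_of_le hK
  obtain ⟨r, hr⟩ := exists_covers K
  have key (n : ℕ) : (n : ℝ) * (‖(h.toFun y : D.V)‖ ^ 2 - ‖(y : B.V) - q‖ ^ 2) ≤ r ^ 2 := by
    rcases Nat.eq_zero_or_pos n with rfl | hn
    · simpa using sq_nonneg r
    obtain ⟨a, ha, har⟩ := hr ((n : ℝ) • q) (Submodule.smul_mem _ _ hq)
    have h1 := h.norm_le (n • y - ⟨a, hK ha⟩)
    rw [map_sub, hh ⟨a, hK ha⟩ ha, sub_zero, map_nsmul] at h1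
    push_cast at h1
    rw [← Nat.cast_smul_eq_nsmul ℝ, ← Nat.cast_smul_eq_nsmul ℝ, norm_smul, Real.norm_natCast] at h1
    have h2 : ‖(n : ℝ) • (y : B.V) - a‖ ^ 2 =
        (n : ℝ) ^ 2 * ‖(y : B.V) - q‖ ^ 2 + ‖(n : ℝ) • q - a‖ ^ 2 := by
      have h3 : inner ℝ ((n : ℝ) • ((y : B.V) - q)) ((n : ℝ) • q - a) = 0 := by
        rw [inner_smul_left, inner_eq_zero_of_mem_span hy, mul_zero]
        exact Submodule.sub_mem _ (Submodule.smul_mem _ _ hq) (Submodule.subset_span ha)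
      have h4 := norm_add_sq_eq_norm_sq_add_norm_sq_of_inner_eq_zero _ _ h3
      rw [smul_sub, sub_add_sub_cancel, ← smul_sub, norm_smul, Real.norm_natCast] at h4
      linarith
    have h5 : ((n : ℝ) * ‖(h.toFun y : D.V)‖) ^ 2 ≤
        (n : ℝ) ^ 2 * ‖(y : B.V) - q‖ ^ 2 + r ^ 2 := by
      refine (pow_le_pow_left₀ (by positivity) h1 2).trans ?_
      rw [h2]
      gcongr
    have h6 : (1 : ℝ) ≤ n := by exact_mod_cast hn
    by_contra! hcon
    nlinarith [sq_nonneg r]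
  by_contra! hlt
  have hpos : 0 < ‖(h.toFun y : D.V)‖ ^ 2 - ‖(y : B.V) - q‖ ^ 2 := by
    have := norm_nonneg ((y : B.V) - q)
    nlinarith
  obtain ⟨n, hn⟩ := exists_nat_gt (r ^ 2 / (‖(h.toFun y : D.V)‖ ^ 2 - ‖(y : B.V) - q‖ ^ 2))
  rw [div_lt_iff₀ hpos] at hn
  exact absurd (key n) (not_le.2 hn)

theorem hom_apply_congr {A B : EucLat.{u}} {f g : A ⟶ B} (h : f = g) (x : A.carrier) :
    f.toFun x = g.toFun x := by rw [h]

/-- The norm bound for `h` gives both the contraction property of the factor and its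
well-definedness, since elements killed by `g` have image of norm 0 under `h`. -/
theorem IsQuotient.exists_unique_factor {B C D : EucLat.{u}} {K : Submodule ℤ B.V}
    (hK : K ≤ B.carrier) {g : B ⟶ C} (hg : IsQuotient K g) (h : B ⟶ D)
    (hh : ∀ y : B.carrier, (y : B.V) ∈ K → h.toFun y = 0) : ∃ k : C ⟶ D, g ≫ k = h := by
  have hle (y : B.carrier) : ‖(h.toFun y : D.V)‖ ≤ ‖(g.toFun y : C.V)‖ := by
    obtain ⟨q, hq, hy, hn⟩ := hg.norm_eq y
    rw [hn]
    exact norm_apply_le_of_vanishing hK h hh y hq hy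
  have hker (y : B.carrier) (hy : g.toFun y = 0) : h.toFun y = 0 := by
    have := hle y
    rw [hy] at this
    exact Subtype.ext (norm_le_zero_iff.1 (by simpa using this))
  let s := Function.surjInv hg.surj
  have hs (c) : g.toFun (s c) = c := Function.surjInv_eq hg.surj c
  have hs' (y : B.carrier) : h.toFun (s (g.toFun y)) = h.toFun y := by
    rw [← sub_eq_zero, ← map_sub]
    exact hker _ (by rw [map_sub, hs, sub_self])
  refine ⟨⟨⟨⟨fun c => h.toFun (s c), ?_⟩, fun c c' => ?_⟩, fun c => ?_⟩, hom_ext fun y => hs' y⟩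
  · exact hker _ (hs 0)
  · change h.toFun (s (c + c')) = h.toFun (s c) + h.toFun (s c')
    rw [← map_add, ← hs' (s c + s c'), map_add, hs, hs]
  · exact (hle (s c)).trans_eq (by rw [hs])

theorem IsQuotient.isColimit {A B C : EucLat.{u}} {f : A ⟶ B} {g : B ⟶ C}
    (hg : IsQuotient (image f) g) (hfg : f ≫ g = 0) :
    Nonempty (IsColimit (CokernelCofork.ofπ g hfg)) := by
  have hfac {D : EucLat.{u}} (h : B ⟶ D) (hh : f ≫ h = 0) : ∃ k : C ⟶ D, g ≫ k = h := by
    refine hg.exists_unique_factor (image_le f) h fun y hy => ?_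
    obtain ⟨x, hx⟩ := hy
    have hx' : f.toFun x = y := Subtype.ext hx
    rw [← hx']
    exact hom_apply_congr hh x
  refine ⟨CokernelCofork.IsColimit.ofπ _ _ (fun h hh => (hfac h hh).choose)
    (fun h hh => (hfac h hh).choose_spec) fun h hh m hm => hom_ext fun c => ?_⟩
  obtain ⟨y, rfl⟩ := hg.surj c
  exact hom_apply_congr (hm.trans (hfac h hh).choose_spec.symm) y

theorem IsConcreteExact.isShortExact {A B C : EucLat.{u}} {f : A ⟶ B} {g : B ⟶ C}
    (h : IsConcreteExact f g) : IsShortExact f g := by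
  have hfg : f ≫ g = 0 := hom_ext fun x => (h.exact _).2 (apply_mem_image f x)
  refine ⟨hfg, ?_, h.quotient.isColimit hfg⟩
  have hinj : Function.Injective f.toFun := by
    refine (injective_iff_map_eq_zero _).2 fun x hx => ?_
    have := h.norm_left x
    rw [hx] at this
    exact Subtype.ext (norm_eq_zero.1 (by simpa using this.symm))
  have hfac {W : EucLat.{u}} (k : W ⟶ B) (hk : k ≫ g = 0) : ∃ l : W ⟶ A, l ≫ f = k := by
    have hex (w : W.carrier) : ∃ x, f.toFun x = k.toFun w := by
      obtain ⟨x, hx⟩ := (h.exact (k.toFun w)).1 (hom_apply_congr hk w)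
      exact ⟨x, Subtype.ext hx⟩
    choose l hl using hex
    refine ⟨⟨⟨⟨l, hinj (by rw [hl, map_zero, map_zero])⟩,
      fun w w' => hinj (by rw [map_add, hl, hl, hl, map_add])⟩, fun w => ?_⟩, hom_ext hl⟩
    refine (h.norm_left (l w)).symm.trans_le ?_
    rw [hl]
    exact k.norm_le w
  refine ⟨KernelFork.IsLimit.ofι _ _ (fun k hk => (hfac k hk).choose)
    (fun k hk => (hfac k hk).choose_spec) fun k hk m hm => hom_ext fun w => hinj ?_⟩
  exact hom_apply_congr (hm.trans (hfac k hk).choose_spec.symm) w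

/-- Both `e` and its inverse are contractions. -/
theorem norm_apply_of_iso {A B : EucLat.{u}} (e : A ≅ B) (x : A.carrier) :
    ‖(e.hom.toFun x : B.V)‖ = ‖(x : A.V)‖ := by
  refine le_antisymm (e.hom.norm_le x) ?_
  have h := e.inv.norm_le (e.hom.toFun x)
  rwa [← comp_apply, hom_apply_congr e.hom_inv_id x] at h

theorem iso_surjective {A B : EucLat.{u}} (e : A ≅ B) : Function.Surjective e.hom.toFun :=
  fun y => ⟨e.inv.toFun y, hom_apply_congr e.inv_hom_id y⟩

/-- The projection of a lattice onto its quotient. -/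
noncomputable def quotMap (B : EucLat.{u}) (K : Submodule ℤ B.V) (hK : K ≤ B.carrier) :
    B ⟶ B.quot K hK :=
  ofLinear (L := B) (M := B.quot K hK) (B.quotProj K) (fun x hx => ⟨x, hx, rfl⟩)
    (Submodule.starProjection_norm_le _)

theorem isQuotient_quotMap (B : EucLat.{u}) (K : Submodule ℤ B.V) (hK : K ≤ B.carrier) :
    IsQuotient K (quotMap B K hK) := by
  refine ⟨?_, fun y => ?_⟩
  · rintro ⟨_, x, hx, rfl⟩
    exact ⟨⟨x, hx⟩, rfl⟩
  · set S := Submodule.span ℝ (K : Set B.V)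
    have h1 : (((quotMap B K hK).toFun y : B.V)) = y - S.starProjection (y : B.V) :=
      Submodule.starProjection_orthogonal_val (K := S) (y : B.V)
    refine ⟨S.starProjection (y : B.V), Submodule.starProjection_apply_mem S _, fun x hx => ?_,
      by rw [← h1]⟩
    exact Submodule.starProjection_inner_eq_zero _ _ (Submodule.subset_span hx)

/-- Kernels and cokernels are unique up to isomorphism, and isomorphisms are isometries; so it
suffices to compare with the group-theoretic kernel and with the projection modulo the image. -/
theorem IsShortExact.isConcreteExact {A B C : EucLat.{u}} {f : A ⟶ B} {g : B ⟶ C}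
    (h : IsShortExact f g) : IsConcreteExact f g := by
  obtain ⟨hfg, ⟨hk⟩, ⟨hc⟩⟩ := h
  obtain ⟨hk'⟩ := ker_isKernel g
  have hmem (y : B.carrier) (hy : (y : B.V) ∈ image f) : g.toFun y = 0 := by
    obtain ⟨x, hx⟩ := hy
    rw [← show f.toFun x = y from Subtype.ext hx]
    exact hom_apply_congr hfg x
  let e : A ≅ ker g := IsLimit.conePointUniqueUpToIso hk hk'
  have he : e.hom ≫ kerι g = f :=
    IsLimit.conePointUniqueUpToIso_hom_comp hk hk' WalkingParallelPair.zero
  have hq := isQuotient_quotMap B (image f) (image_le f)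
  have hfq : f ≫ quotMap B (image f) (image_le f) = 0 := hom_ext fun x => by
    obtain ⟨q, hq, hy, hn⟩ := hq.norm_eq (f.toFun x)
    have h1 : inner ℝ ((f.toFun x : B.V) - q) ((f.toFun x : B.V) - q) = 0 :=
      inner_eq_zero_of_mem_span hy
        (Submodule.sub_mem _ (Submodule.subset_span (apply_mem_image f x)) hq)
    rw [inner_self_eq_zero] at h1
    rw [h1, norm_zero, norm_eq_zero] at hn
    exact Subtype.ext hn
  obtain ⟨hc'⟩ := hq.isColimit hfq
  let e' : B.quot (image f) (image_le f) ≅ C := IsColimit.coconePointUniqueUpToIso hc' hc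
  have he' : quotMap B (image f) (image_le f) ≫ e'.hom = g :=
    IsColimit.comp_coconePointUniqueUpToIso_hom hc' hc WalkingParallelPair.one
  refine ⟨fun x => ?_, fun y => ⟨fun hy => ?_, hmem y⟩, ?_, fun y => ?_⟩
  · rw [← hom_apply_congr he x]
    exact norm_apply_of_iso e x
  · obtain ⟨x, hx⟩ := iso_surjective e ⟨y, y, hy, rfl⟩
    refine ⟨x, ?_⟩
    have h1 := hom_apply_congr he x
    rw [comp_apply, hx] at h1
    exact congrArg Subtype.val h1.symm
  · have h1 := (iso_surjective e').comp hq.surj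
    rw [← he']
    exact h1
  · obtain ⟨q, hq, hy, hn⟩ := hq.norm_eq y
    refine ⟨q, hq, hy, ?_⟩
    rw [← hom_apply_congr he' y, ← hn]
    exact norm_apply_of_iso e' _

end EucLat

/-! ### Invariance and monotonicity of theta sums -/

section

variable {V : Type*} [NormedAddCommGroup V] {W : Type*} [NormedAddCommGroup W]

theorem theta_congr {L : Submodule ℤ V} {M : Submodule ℤ W} (e : L ≃ M)
    (h : ∀ x, ‖(e x : W)‖ = ‖(x : V)‖) (t : ℝ) : theta L t 0 = theta M t 0 := by
  rw [theta, theta, ← e.tsum_eq]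
  exact tsum_congr fun x => by simp [h]

theorem theta_mono {K L : Submodule ℤ V} (h : K ≤ L) (t : ℝ) : theta K t 0 ≤ theta L t 0 := by
  classical
  rw [theta, ENNReal.tsum_subtype_of_le h fun y => expNeg (Real.pi * t * ‖y + 0‖ ^ 2)]
  refine ENNReal.tsum_le_tsum fun x => ?_
  split_ifs
  · exact le_rfl
  · exact zero_le

theorem logTheta_congr {L : Submodule ℤ V} {M : Submodule ℤ W} (e : L ≃ M)
    (h : ∀ x, ‖(e x : W)‖ = ‖(x : V)‖) (t : ℝ) : logTheta L t = logTheta M t := by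
  rw [logTheta, logTheta, theta_congr e h]

theorem logTheta_bot (t : ℝ) : logTheta (⊥ : Submodule ℤ V) t = 0 := by
  rw [logTheta, theta, tsum_eq_single (0 : (⊥ : Submodule ℤ V))
    fun x hx => absurd (Subsingleton.elim x 0) hx]
  simp

theorem logDensity_congr {L : Submodule ℤ V} {M : Submodule ℤ W} (e : L ≃ₗ[ℤ] M)
    (h : ∀ x, ‖(e x : W)‖ = ‖(x : V)‖) : logDensity L = logDensity M := by
  rw [logDensity, logDensity]
  refine iInf_congr fun k => ?_
  rw [logDensityApprox, logDensityApprox, logTheta_congr e.toEquiv h, e.finrank_eq]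

variable [InnerProductSpace ℝ V] [FiniteDimensional ℝ V] [InnerProductSpace ℝ W]
  [FiniteDimensional ℝ W]

theorem logTheta_mono {K L : Submodule ℤ V} [DiscreteTopology K] [DiscreteTopology L] (h : K ≤ L)
    {t : ℝ} (ht : 0 < t) : logTheta K t ≤ logTheta L t :=
  Real.log_le_log (by linarith [one_le_toReal_theta K ht])
    (ENNReal.toReal_mono (theta_lt_top L ht 0).ne (theta_mono h t))

end

namespace EucLat

theorem ell_eq_logTheta (L : EucLat.{u}) : L.ell = logTheta L.carrier 1 := by
  rw [ell, rho, logTheta, toReal_theta]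
  congr 1
  exact tsum_congr fun x => by ring_nf

theorem ell_nonneg (L : EucLat.{u}) : 0 ≤ L.ell := by
  rw [ell_eq_logTheta]
  exact logTheta_nonneg _ one_pos

instance {A B : EucLat.{u}} (f : A ⟶ B) : DiscreteTopology (ker f).carrier := (ker f).discrete

/-! ### The rank -/

theorem mem_ker {A B : EucLat.{u}} {f : A ⟶ B} {x : A.carrier} :
    (x : A.V) ∈ (ker f).carrier ↔ f.toFun x = 0 := by
  constructor
  · rintro ⟨y, hy, hyx⟩
    rw [← show y = x from Subtype.ext hyx]
    exact hy
  · exact fun h => ⟨x, h, rfl⟩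

theorem ker_le {A B : EucLat.{u}} (f : A ⟶ B) : (ker f).carrier ≤ A.carrier := by
  rintro _ ⟨y, -, rfl⟩
  exact y.2

theorem rk_id (L : EucLat.{u}) : rk (𝟙 L) = L.ell := by
  have h : (ker (𝟙 L)).carrier = ⊥ := by
    rw [eq_bot_iff]
    rintro _ ⟨y, hy, rfl⟩
    have hy' : y = 0 := hy
    simp [hy']
  rw [rk, ell_eq_logTheta (ker _), h, logTheta_bot, sub_zero]

theorem isRank_rk : IsRank rk.{u} := by
  refine ⟨fun A B f => ?_, fun A B D f g => ⟨?_, ?_⟩⟩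
  · rw [rk, ell_eq_logTheta, ell_eq_logTheta, sub_nonneg]
    exact logTheta_mono (V := A.V) (ker_le f) one_pos
  · rw [rk, rk, ell_eq_logTheta (ker f), ell_eq_logTheta (ker _)]
    refine sub_le_sub_left (logTheta_mono (V := A.V) ?_ one_pos) _
    rintro _ ⟨y, hy, rfl⟩
    have hy' : f.toFun y = 0 := hy
    exact mem_ker.2 (by rw [comp_apply, hy', map_zero])
  · set A₀ := (ker (f ≫ g)).carrier
    set K := (ker g).carrier
    have h1 (t : ℝ) (ht : 0 < t) (ht1 : t < 1) :
        (theta A.carrier 1 0).toReal * (theta K t 0).toReal ≤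
          (theta A₀ 1 0).toReal * (theta B.carrier t 0).toReal := by
      have h := theta_mul_theta_le_of_contraction A.carrier A₀ B.carrier K f.toFun f.norm_le
        (ker_le _) (ker_le _) (fun x => by rw [mem_ker, mem_ker, comp_apply]) ht ht1
      have h2 := ENNReal.toReal_mono (ENNReal.mul_ne_top (theta_lt_top A₀ one_pos 0).ne
        (theta_lt_top B.carrier ht 0).ne) h
      rwa [ENNReal.toReal_mul, ENNReal.toReal_mul] at h2
    -- The comparison is available only for `t < 1`; the wanted inequality is its limit as `t → 1`.
    have h2 := le_of_tendsto_of_tendsto ((tendsto_toReal_theta_one K).const_mul _)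
      ((tendsto_toReal_theta_one B.carrier).const_mul _) (by
        filter_upwards [self_mem_nhdsWithin, mem_nhdsWithin_of_mem_nhds (Ioi_mem_nhds one_pos)]
          with t ht1 ht
        exact h1 t ht ht1)
    have p1 := one_le_toReal_theta A.carrier one_pos
    have p2 := one_le_toReal_theta K one_pos
    have p3 := one_le_toReal_theta A₀ one_pos
    have p4 := one_le_toReal_theta B.carrier one_pos
    have h3 := Real.log_le_log (by positivity) h2
    rw [Real.log_mul (by positivity) (by positivity),
      Real.log_mul (by positivity) (by positivity)] at h3
    rw [rk, rk, ell_eq_logTheta, ell_eq_logTheta, ell_eq_logTheta, ell_eq_logTheta]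
    simp only [logTheta]
    linarith

/-! ### Theta sums in short exact sequences -/

section Exact

variable {A B C : EucLat.{u}} {f : A ⟶ B} {g : B ⟶ C}

theorem discreteTopology_image (f : A ⟶ B) : DiscreteTopology (image f) :=
  discreteTopology_of_le (image_le f)

/-- A group isomorphism onto the image of a morphism that preserves the norm. -/
noncomputable def equivImage (h : IsConcreteExact f g) : A.carrier ≃ₗ[ℤ] image f :=
  LinearEquiv.ofInjective (B.carrier.subtype ∘ₗ f.toFun.toIntLinearMap) <|
    (injective_iff_map_eq_zero _).2 fun x hx => by
      have h1 := h.norm_left x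
      have h2 : (f.toFun x : B.V) = 0 := hx
      rw [h2, norm_zero] at h1
      exact Subtype.ext (norm_eq_zero.1 h1.symm)

theorem logTheta_image (h : IsConcreteExact f g) (t : ℝ) :
    logTheta (image f) t = logTheta A.carrier t :=
  (logTheta_congr (equivImage h).toEquiv (fun x => h.norm_left x) t).symm

theorem logDensity_image (h : IsConcreteExact f g) :
    logDensity (image f) = logDensity A.carrier :=
  (logDensity_congr (equivImage h) fun x => h.norm_left x).symm

theorem finrank_of_isConcreteExact (h : IsConcreteExact f g) :
    Module.finrank ℤ B.carrier = Module.finrank ℤ (image f) + Module.finrank ℤ C.carrier := by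
  have h1 := Submodule.finrank_quotient_add_finrank (LinearMap.ker g.toFun.toIntLinearMap)
  have h2 := (g.toFun.toIntLinearMap.quotKerEquivOfSurjective h.quotient.surj).finrank_eq
  have h3 : (LinearMap.ker g.toFun.toIntLinearMap).map B.carrier.subtype = image f := by
    ext y
    constructor
    · rintro ⟨z, hz, rfl⟩
      exact (h.exact z).1 hz
    · intro hy
      exact ⟨⟨y, image_le f hy⟩, (h.exact ⟨y, image_le f hy⟩).2 hy, rfl⟩
  have h4 := (Submodule.equivMapOfInjective B.carrier.subtype Subtype.val_injective
    (LinearMap.ker g.toFun.toIntLinearMap)).finrank_eq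
  rw [h3] at h4
  omega

/-- Pythagoras: `s c - q c` is orthogonal to the real span of the image and has the norm of `c`. The
scalar `a` is kept because both `a = 1` and `a = N` are used. -/
theorem exists_section (h : IsConcreteExact f g) :
    ∃ (s : C.carrier → B.carrier) (q : C.carrier → B.V),
      (∀ c, g.toFun (s c) = c) ∧ (∀ c, q c ∈ Submodule.span ℝ (image f : Set B.V)) ∧
      ∀ c, ∀ x ∈ Submodule.span ℝ (image f : Set B.V), ∀ a : ℝ,
        ‖a • (s c : B.V) + x‖ ^ 2 = a ^ 2 * ‖(c : C.V)‖ ^ 2 + ‖x + a • q c‖ ^ 2 := by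
  obtain ⟨s, hs⟩ := h.quotient.surj.hasRightInverse
  choose q hq hy hn using fun c => h.quotient.norm_eq (s c)
  refine ⟨s, q, hs, hq, fun c x hx a => ?_⟩
  have h1 : inner ℝ (a • ((s c : B.V) - q c)) (x + a • q c) = 0 := by
    rw [inner_smul_left, inner_eq_zero_of_mem_span (hy c)
      (Submodule.add_mem _ hx (Submodule.smul_mem _ _ (hq c))), mul_zero]
  have h2 := norm_add_sq_eq_norm_sq_add_norm_sq_of_inner_eq_zero _ _ h1
  rw [norm_smul, ← hn, hs] at h2
  have h3 : a • ((s c : B.V) - q c) + (x + a • q c) =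
      a • (s c : B.V) + x := by
    rw [smul_sub]
    abel
  rw [h3] at h2
  rw [sq, h2, ← sq_abs a, ← Real.norm_eq_abs]
  ring

theorem tsum_section (h : IsConcreteExact f g) {s : C.carrier → B.carrier}
    (hs : ∀ c, g.toFun (s c) = c) (F : B.V → ℝ≥0∞) :
    ∑' b : B.carrier, F b = ∑' c, ∑' a : image f, F (s c + a) := by
  rw [← ENNReal.tsum_prod (f := fun c (a : image f) => F (s c + a))]
  have hmem (a : image f) : g.toFun ⟨a, image_le f a.2⟩ = 0 := (h.exact _).2 a.2
  have hbij : Function.Bijective fun p : C.carrier × image f =>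
      s p.1 + (⟨p.2, image_le f p.2.2⟩ : B.carrier) := by
    constructor
    · rintro ⟨c, a⟩ ⟨c', a'⟩ hp
      have h1 := congrArg g.toFun hp
      simp only [map_add, hmem, hs, add_zero] at h1
      subst h1
      have h2 := add_left_cancel hp
      have h3 : (a : B.V) = a' := congrArg (fun z : B.carrier => (z : B.V)) h2
      rw [Subtype.ext h3]
    · intro b
      have h1 : g.toFun (b - s (g.toFun b)) = 0 := by rw [map_sub, hs, sub_self]
      refine ⟨⟨g.toFun b, ⟨_, (h.exact _).1 h1⟩⟩, ?_⟩
      exact add_sub_cancel _ _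
  rw [← (Equiv.ofBijective _ hbij).tsum_eq]
  rfl

/-- The coset over `c` contributes the Gaussian of `c` times a theta sum of the image translated
within its span, which is compared with the untranslated one on both sides. -/
theorem theta_mul_theta_bounds (h : IsConcreteExact f g) {t : ℝ} (ht : 0 < t) {r : ℝ}
    (hr : Covers (image f) r) :
    expNeg (Real.pi * t * r ^ 2) * (theta (image f) t 0 * theta C.carrier t 0) ≤
      theta B.carrier t 0 ∧
    theta B.carrier t 0 ≤ theta (image f) t 0 * theta C.carrier t 0 := by
  have := discreteTopology_image f
  obtain ⟨s, q, hs, hq, hn⟩ := exists_section h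
  have h1 : theta B.carrier t 0 =
      ∑' c : C.carrier, expNeg (Real.pi * t * ‖(c : C.V)‖ ^ 2) * theta (image f) t (q c) := by
    rw [theta, tsum_section h hs fun y => expNeg (Real.pi * t * ‖y + 0‖ ^ 2)]
    refine tsum_congr fun c => ?_
    rw [theta, ← ENNReal.tsum_mul_left]
    refine tsum_congr fun a => ?_
    have h2 := hn c a (Submodule.subset_span a.2) 1
    rw [one_smul, one_smul, one_pow, one_mul] at h2
    rw [← expNeg_add, add_zero, h2, mul_add]
  have h2 : theta C.carrier t 0 = ∑' c : C.carrier, expNeg (Real.pi * t * ‖(c : C.V)‖ ^ 2) := by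
    simp [theta]
  rw [h1, h2, ← ENNReal.tsum_mul_left, ← ENNReal.tsum_mul_left]
  constructor <;> refine ENNReal.tsum_le_tsum fun c => ?_
  · rw [mul_comm (theta (image f) t 0), mul_left_comm]
    gcongr
    exact le_theta_of_covers hr ht.le (hq c)
  · rw [mul_comm]
    gcongr
    exact theta_le _ ht (hq c)

/-- Compute the Gaussian sum of the overlattice `B + N⁻¹ f(A)` in two ways. Over `C` it is a sum of
translates of the refined image; over classes modulo `N f(A)` it is a sum of `N ^ rank` translates
of `B`, each at most the sum of `B`. -/
theorem theta_mul_theta_le_pow_mul (h : IsConcreteExact f g) {r : ℝ} (hr : Covers (image f) r)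
    (N : ℕ) [NeZero N] {t : ℝ} (ht : (N : ℝ) ^ 2 * t = 1) :
    expNeg (Real.pi * t * r ^ 2) * (theta (image f) t 0 * theta C.carrier 1 0) ≤
      (N : ℝ≥0∞) ^ Module.finrank ℤ (image f) * theta B.carrier 1 0 := by
  have := discreteTopology_image f
  have hN : (N : ℝ) ≠ 0 := Nat.cast_ne_zero.2 (NeZero.ne N)
  have ht0 : 0 < t := pos_of_mul_pos_right (ht ▸ one_pos) (sq_nonneg _)
  obtain ⟨s, q, hs, hq, hn⟩ := exists_section h
  obtain ⟨rep, hrep⟩ := exists_division (image f) N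
  have h1 : ∑' c, ∑' a : image f, expNeg (Real.pi * t * ‖(N : ℝ) • (s c : B.V) + a‖ ^ 2) =
      ∑' c : C.carrier, expNeg (Real.pi * ‖(c : C.V)‖ ^ 2) *
        theta (image f) t ((N : ℝ) • q c) := by
    refine tsum_congr fun c => ?_
    rw [theta, ← ENNReal.tsum_mul_left]
    refine tsum_congr fun a => ?_
    rw [← expNeg_add, hn c a (Submodule.subset_span a.2) N]
    congr 1
    linear_combination Real.pi * ‖(c : C.V)‖ ^ 2 * ht
  have h2 : ∑' c, ∑' a : image f, expNeg (Real.pi * t * ‖(N : ℝ) • (s c : B.V) + a‖ ^ 2) =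
      ∑ i, theta B.carrier 1 ((N : ℝ)⁻¹ • (rep i : B.V)) := by
    have h3 (c) := ENNReal.tsum_division hrep
      fun a => expNeg (Real.pi * t * ‖(N : ℝ) • (s c : B.V) + a‖ ^ 2)
    simp_rw [h3]
    rw [Summable.tsum_finsetSum fun _ _ => ENNReal.summable]
    refine Finset.sum_congr rfl fun i _ => ?_
    rw [theta, tsum_section h hs
      fun y => expNeg (Real.pi * 1 * ‖y + (N : ℝ)⁻¹ • (rep i : B.V)‖ ^ 2)]
    refine tsum_congr fun c => tsum_congr fun a => ?_
    have h4 : (N : ℝ) • (s c : B.V) + ((rep i + N • a : image f) : B.V) =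
        (N : ℝ) • ((s c : B.V) + a + (N : ℝ)⁻¹ • (rep i : B.V)) := by
      rw [smul_add, smul_add, smul_inv_smul₀ hN]
      push_cast
      rw [Nat.cast_smul_eq_nsmul ℝ N (a : B.V)]
      abel
    rw [h4, norm_smul, mul_pow, Real.norm_natCast]
    congr 1
    linear_combination Real.pi * ‖(s c : B.V) + a + (N : ℝ)⁻¹ • (rep i : B.V)‖ ^ 2 * ht
  have h5 : theta C.carrier 1 0 = ∑' c : C.carrier, expNeg (Real.pi * ‖(c : C.V)‖ ^ 2) := by
    simp [theta]
  calc expNeg (Real.pi * t * r ^ 2) * (theta (image f) t 0 * theta C.carrier 1 0)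
      ≤ ∑' c : C.carrier, expNeg (Real.pi * ‖(c : C.V)‖ ^ 2) *
        theta (image f) t ((N : ℝ) • q c) := by
        rw [h5, ← ENNReal.tsum_mul_left, ← ENNReal.tsum_mul_left]
        refine ENNReal.tsum_le_tsum fun c => ?_
        rw [mul_comm (theta (image f) t 0), mul_left_comm]
        gcongr
        exact le_theta_of_covers hr ht0.le (Submodule.smul_mem _ _ (hq c))
    _ = ∑ i, theta B.carrier 1 ((N : ℝ)⁻¹ • (rep i : B.V)) := by rw [← h1, h2]
    _ ≤ _ := by
        refine (Finset.sum_le_card_nsmul _ _ (theta B.carrier 1 0) fun i _ =>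
          theta_le _ one_pos ?_).trans ?_
        · exact Submodule.smul_mem _ _ (Submodule.subset_span (image_le f (rep i).2))
        · simp

/-! ### Numerical inequalities in short exact sequences -/

theorem logTheta_bounds (h : IsConcreteExact f g) {t : ℝ} (ht : 0 < t) {r : ℝ}
    (hr : Covers (image f) r) :
    logTheta A.carrier t + logTheta C.carrier t - Real.pi * t * r ^ 2 ≤ logTheta B.carrier t ∧
      logTheta B.carrier t ≤ logTheta A.carrier t + logTheta C.carrier t := by
  have := discreteTopology_image f
  have h1 := theta_mul_theta_bounds h ht hr
  rw [theta_eq_expNeg_logTheta _ ht, theta_eq_expNeg_logTheta _ ht, theta_eq_expNeg_logTheta _ ht,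
    ← expNeg_add, ← expNeg_add, expNeg_le_expNeg_iff, expNeg_le_expNeg_iff,
    logTheta_image h] at h1
  constructor <;> linarith [h1.1, h1.2]

theorem ell_le_of_isConcreteExact (h : IsConcreteExact f g) : A.ell ≤ B.ell := by
  have := discreteTopology_image f
  rw [ell_eq_logTheta, ell_eq_logTheta, ← logTheta_image h]
  exact logTheta_mono (image_le f) one_pos

theorem ell_middle_le (h : IsConcreteExact f g) : B.ell ≤ A.ell + C.ell := by
  have := discreteTopology_image f
  obtain ⟨r, hr⟩ := exists_covers (image f)
  rw [ell_eq_logTheta, ell_eq_logTheta, ell_eq_logTheta]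
  exact (logTheta_bounds h one_pos hr).2

theorem tendsto_pi_mul_pow (r : ℝ) :
    Tendsto (fun k : ℕ => Real.pi * (4 : ℝ)⁻¹ ^ k * r ^ 2) atTop (𝓝 0) := by
  have h := ((tendsto_pow_atTop_nhds_zero_of_lt_one (r := (4 : ℝ)⁻¹) (by norm_num)
    (by norm_num)).const_mul Real.pi).mul_const (r ^ 2)
  simpa using h

/-- The error `π t r²` in the coset bounds disappears at `t = 4⁻ᵏ`, and the normalising terms cancel
because ranks add. -/
theorem logDensity_add (h : IsConcreteExact f g) :
    logDensity B.carrier = logDensity A.carrier + logDensity C.carrier := by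
  have := discreteTopology_image f
  obtain ⟨r, hr⟩ := exists_covers (image f)
  have hd := finrank_of_isConcreteExact h
  rw [← (equivImage h).finrank_eq] at hd
  have h1 (k : ℕ) := logTheta_bounds h (t := (4 : ℝ)⁻¹ ^ k) (by positivity) hr
  have hAC := (tendsto_logDensityApprox A.carrier).add (tendsto_logDensityApprox C.carrier)
  refine tendsto_nhds_unique (tendsto_logDensityApprox B.carrier)
    (tendsto_of_tendsto_of_tendsto_of_le_of_le
      ((hAC.sub (tendsto_pi_mul_pow r)).trans_eq (by rw [sub_zero])) hAC (fun k => ?_) fun k => ?_)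
  all_goals
    simp only [logDensityApprox, hd, Nat.cast_add]
    linarith [(h1 k).1, (h1 k).2]

/-- Take `N = 2ᵏ` in the overlattice inequality and let `k → ∞`: refining `A` turns its contribution
into its density. -/
theorem logDensity_add_ell_le (h : IsConcreteExact f g) :
    logDensity A.carrier + C.ell ≤ B.ell := by
  have := discreteTopology_image f
  obtain ⟨r, hr⟩ := exists_covers (image f)
  have h1 (k : ℕ) : logDensityApprox (image f) k + C.ell - Real.pi * (4 : ℝ)⁻¹ ^ k * r ^ 2 ≤
      B.ell := by
    have ht : (0 : ℝ) < (4 : ℝ)⁻¹ ^ k := by positivity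
    have e : ((2 ^ k : ℕ) : ℝ) ^ 2 * (4 : ℝ)⁻¹ ^ k = 1 := by
      rw [Nat.cast_pow, ← pow_mul, mul_comm k 2, pow_mul, ← mul_pow]
      norm_num
    have h2 := theta_mul_theta_le_pow_mul h hr (2 ^ k) e
    rw [theta_eq_expNeg_logTheta _ ht, theta_eq_expNeg_logTheta _ one_pos,
      theta_eq_expNeg_logTheta _ one_pos, natCast_pow_eq_expNeg (NeZero.ne _),
      ← expNeg_add, ← expNeg_add, ← expNeg_add, expNeg_le_expNeg_iff, Nat.cast_pow,
      Real.log_pow] at h2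
    rw [logDensityApprox, ell_eq_logTheta, ell_eq_logTheta]
    push_cast at h2
    linarith
  rw [← logDensity_image h]
  have h3 : Tendsto (fun k => logDensityApprox (image f) k + C.ell -
      Real.pi * (4 : ℝ)⁻¹ ^ k * r ^ 2) atTop (𝓝 (logDensity (image f) + C.ell)) := by
    simpa using ((tendsto_logDensityApprox (image f)).add_const C.ell).sub (tendsto_pi_mul_pow r)
  exact le_of_tendsto' h3 h1

end Exact

end EucLat

/-! ### Alternating sums and uniqueness of effaceable delta-functors -/

/-- The alternating sum `e k - e (k-1) + e (k-2) - ...`. -/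
def altSum (e : ℕ → ℝ) (k : ℕ) : ℝ := ∑ j ∈ Finset.range (k + 1), (-1 : ℝ) ^ j * e (k - j)

theorem altSum_zero (e : ℕ → ℝ) : altSum e 0 = e 0 := by simp [altSum]

theorem altSum_succ (e : ℕ → ℝ) (k : ℕ) : altSum e (k + 1) = e (k + 1) - altSum e k := by
  rw [altSum, Finset.sum_range_succ', altSum, sub_eq_neg_add, ← Finset.sum_neg_distrib]
  simp [pow_succ]

theorem altSum_congr {e e' : ℕ → ℝ} {k : ℕ} (h : ∀ j ≤ k, e j = e' j) :
    altSum e k = altSum e' k :=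
  Finset.sum_congr rfl fun j _ => by rw [h _ (Nat.sub_le k j)]

section Longsequence

variable {O : Type u} {E : O → O → O → Prop} {T T' : ℕ → O → ℝ} (A B C : O) (i : ℕ)

theorem longSequence_left : longSequence T A B C (3 * i) = T i A := by
  simp [longSequence]

theorem longSequence_middle : longSequence T A B C (3 * i + 1) = T i B := by
  rw [longSequence, if_neg (by omega), if_pos (by omega), show (3 * i + 1) / 3 = i by omega]

variable {i}

/-- Let `S` be the alternating sum ending at `Tⁱ(C)`, common to both functors. Positivity at the
next term gives `S ≤ T'ⁱ⁺¹(A)`, and positivity one place later gives `Tⁱ⁺¹(A) ≤ S + Tⁱ⁺¹(B) ≤ S +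
ε`. -/
theorem IsNumericalDeltaFunctor.le_of_isEffaceable (hT : IsNumericalDeltaFunctor E T)
    (hT' : IsNumericalDeltaFunctor E T') (heff : IsEffaceable E (T (i + 1)))
    (h : ∀ j ≤ i, T j = T' j) : T (i + 1) A ≤ T' (i + 1) A := by
  refine le_of_forall_pos_le_add fun ε hε => ?_
  obtain ⟨B, C, hE, hB⟩ := heff A ε hε
  have h1 : 0 ≤ altSum (longSequence T A B C) (3 * (i + 1) + 1) := (hT.2 A B C hE).2 _
  have h2 : 0 ≤ altSum (longSequence T' A B C) (3 * (i + 1)) := (hT'.2 A B C hE).2 _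
  have h3 : altSum (longSequence T A B C) (3 * i + 2) =
      altSum (longSequence T' A B C) (3 * i + 2) := altSum_congr fun j hj => by
    simp only [longSequence, h (j / 3) (by omega)]
  rw [altSum_succ, longSequence_middle] at h1
  rw [show 3 * (i + 1) = 3 * i + 2 + 1 by ring, altSum_succ,
    show 3 * i + 2 + 1 = 3 * (i + 1) by ring, longSequence_left] at h1 h2
  linarith

theorem IsEffaceableDeltaFunctor.unique (hT : IsEffaceableDeltaFunctor E T)
    (hT' : IsEffaceableDeltaFunctor E T') (h : T 0 = T' 0) : T = T' := by
  suffices ∀ i, ∀ j ≤ i, T j = T' j from funext fun i => this i i le_rfl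
  intro i
  induction i with
  | zero =>
    intro j hj
    rw [Nat.le_zero.1 hj, h]
  | succ i ih =>
    intro j hj
    rcases Nat.le_succ_iff.1 hj with hj | rfl
    · exact ih j hj
    · exact funext fun A => le_antisymm
        (hT.1.le_of_isEffaceable A hT'.1 (hT.2 _ (Nat.le_add_left _ _)) ih)
        (hT'.1.le_of_isEffaceable A hT.1 (hT'.2 _ (Nat.le_add_left _ _)) fun j hj => (ih j hj).symm)

end Longsequence

/-! ### The cohomology of lattices -/

namespace EucLat

/-- The numerical cohomology of lattices: `ℓ`, then `ℓ` plus the logarithm of the covolume, then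
zero. -/
noncomputable def cohomology : ℕ → EucLat.{u} → ℝ
  | 0, L => L.ell
  | 1, L => L.ell - logDensity L.carrier
  | _ + 2, _ => 0

theorem cohomology_nonneg (i : ℕ) (L : EucLat.{u}) : 0 ≤ cohomology i L :=
  match i with
  | 0 => ell_nonneg L
  | 1 => by
    rw [cohomology, ell_eq_logTheta, sub_nonneg]
    exact logDensity_le _
  | _ + 2 => le_rfl

/-- This is how tightness kills cohomology: short generators give a small covering radius. -/
theorem cohomology_one_le (L : EucLat.{u}) {r : ℝ} (hr : Covers L.carrier r) :
    cohomology 1 L ≤ Real.pi * r ^ 2 := by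
  have := le_logDensity L.carrier hr
  rw [cohomology, ell_eq_logTheta]
  linarith

theorem isNumericalDeltaFunctor_cohomology :
    IsNumericalDeltaFunctor (ShortExactTriple EucLat.{u}) cohomology.{u} := by
  refine ⟨cohomology_nonneg, fun A B C hE => ?_⟩
  obtain ⟨f, g, hfg⟩ := hE
  have h := IsShortExact.isConcreteExact hfg
  refine ⟨fun k => ?_, ?_⟩
  · rw [longSequence]
    split_ifs <;> exact cohomology_nonneg _ _
  set e := longSequence cohomology.{u} A B C with he
  have h0 : altSum e 0 = A.ell := altSum_zero e
  have h1 : altSum e 1 = B.ell - A.ell := by rw [altSum_succ, h0]; rfl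
  have h2 : altSum e 2 = C.ell - B.ell + A.ell := by
    rw [altSum_succ, h1, ← sub_add]; rfl
  have h3 : altSum e 3 = B.ell - C.ell - logDensity A.carrier := by
    rw [altSum_succ, h2, show e 3 = A.ell - logDensity A.carrier from rfl]; ring
  -- Additivity of `logDensity` enters here, and makes every later alternating sum vanish.
  have h4 : altSum e 4 = C.ell - logDensity C.carrier := by
    rw [altSum_succ, h3, show e 4 = B.ell - logDensity B.carrier from rfl, logDensity_add h]; ring
  have h5 (k : ℕ) : altSum e (k + 5) = 0 := by
    induction k with
    | zero =>
      rw [altSum_succ, h4, show e 5 = C.ell - logDensity C.carrier from rfl, sub_self]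
    | succ k ih =>
      rw [show k + 1 + 5 = k + 5 + 1 by ring, altSum_succ, ih, sub_zero, he, longSequence]
      obtain ⟨m, hm⟩ : ∃ m, (k + 5 + 1) / 3 = m + 2 := ⟨(k + 5 + 1) / 3 - 2, by omega⟩
      rw [hm]
      split_ifs <;> rfl
  intro k
  change 0 ≤ altSum e k
  match k with
  | 0 => exact h0 ▸ ell_nonneg A
  | 1 => rw [h1]; linarith [ell_le_of_isConcreteExact h]
  | 2 => rw [h2]; linarith [ell_middle_le h]
  | 3 => rw [h3]; linarith [logDensity_add_ell_le h]
  | 4 => rw [h4]; exact cohomology_nonneg 1 C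
  | k + 5 => exact (h5 k).ge

end EucLat

namespace EucLat

/-! ### The resolution is exact -/

section Resolution

variable (n : ℕ+) (L : EucLat.{u})

theorem quotProj_unitVec : (P n).quotProj (intInP n) (unitVec n) = 0 := by
  rw [Submodule.starProjection_apply_eq_zero_iff]
  exact Submodule.le_orthogonal_orthogonal _
    (Submodule.subset_span (Submodule.subset_span (Set.mem_singleton _)))

theorem inner_quotProj_unitVec (x : EuclideanSpace ℝ (Fin 2)) :
    inner ℝ ((P n).quotProj (intInP n) x) (unitVec n) = 0 := by
  rw [real_inner_comm]
  exact Submodule.inner_right_of_mem_orthogonal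
    (Submodule.subset_span (Submodule.subset_span (Set.mem_singleton _)))
    (Submodule.starProjection_apply_mem _ x)

theorem exists_smul_add_quotProj (x : EuclideanSpace ℝ (Fin 2)) :
    ∃ κ : ℝ, x = κ • unitVec n + (P n).quotProj (intInP n) x := by
  set S := Submodule.span ℝ (intInP n : Set (P n).V) with hS
  have h1 : (P n).quotProj (intInP n) x = x - S.starProjection x :=
    Submodule.starProjection_orthogonal_val (K := S) x
  have h2 : S.starProjection x ∈ Submodule.span ℝ {unitVec n} := by
    have h3 : S = Submodule.span ℝ {unitVec n} := by
      rw [hS, intInP, Submodule.span_span_of_tower]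
    exact h3 ▸ Submodule.starProjection_apply_mem S x
  obtain ⟨κ, hκ⟩ := Submodule.mem_span_singleton.1 h2
  exact ⟨κ, by rw [hκ, h1, add_sub_cancel]⟩

/-- A multiple of `unitVec n` with first coordinate 0 is 0. The case does occur, for `n = 1`, where
`P_1` has rank one. -/
theorem genB_eq_zero_of_quotProj (h : (P n).quotProj (intInP n) (genB n) = 0) : genB n = 0 := by
  obtain ⟨κ, hκ⟩ := exists_smul_add_quotProj n (genB n)
  rw [h, add_zero] at hκ
  have h1 := congrArg (fun x : EuclideanSpace ℝ (Fin 2) => x 0) hκ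
  have h2 : κ = 0 := by simpa [genB, unitVec] using h1
  rw [hκ, h2, zero_smul]

theorem genA_eq : genA n = unitVec n - (n : ℤ) • genB n := by
  have hn : (0 : ℝ) < n := by exact_mod_cast n.pos
  have hs : √(1 - 1 / (n : ℝ) ^ 2) = n * √(1 / (n : ℝ) ^ 2 - 1 / (n : ℝ) ^ 4) := by
    rw [← Real.sqrt_sq hn.le, ← Real.sqrt_mul (sq_nonneg _), Real.sqrt_sq hn.le]
    congr 1
    field_simp
  ext i
  fin_cases i <;> simp [unitVec, genA, genB]
  rw [eq_comm, sub_eq_zero]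
  simpa using hs

variable {n L}

/-- As `unitVec n = genA n + n • genB n`, the lattice `P_n` is also generated by `unitVec n` and
`genB n`, and the differential kills the first. -/
theorem exists_eq_of_mem_tensor {z : EuclideanSpace ℝ (Fin 2) ⊗[ℝ] L.V}
    (hz : z ∈ ((P n).tensor L).carrier) :
    ∃ x ∈ L.carrier, ∃ y ∈ L.carrier, z = unitVec n ⊗ₜ[ℝ] x + genB n ⊗ₜ[ℝ] y := by
  induction hz using Submodule.span_induction with
  | mem z hz =>
    obtain ⟨p, hp, y, hy, rfl⟩ := hz
    obtain ⟨a, b, rfl⟩ := Submodule.mem_span_pair.1 hp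
    refine ⟨a • y, L.carrier.smul_mem a hy, (b - a * n) • y, L.carrier.smul_mem _ hy, ?_⟩
    have h1 : a • genA n + b • genB n = a • unitVec n + (b - a * n) • genB n := by
      rw [genA_eq]
      module
    simp only [h1, TensorProduct.add_tmul, ← TensorProduct.smul_tmul]
  | zero => exact ⟨0, L.carrier.zero_mem, 0, L.carrier.zero_mem, by simp⟩
  | add z z' _ _ hz hz' =>
    obtain ⟨x, hx, y, hy, rfl⟩ := hz
    obtain ⟨x', hx', y', hy', rfl⟩ := hz'
    refine ⟨x + x', L.carrier.add_mem hx hx', y + y', L.carrier.add_mem hy hy', ?_⟩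
    simp only [TensorProduct.tmul_add]
    abel
  | smul a z _ hz =>
    obtain ⟨x, hx, y, hy, rfl⟩ := hz
    refine ⟨a • x, L.carrier.smul_mem a hx, a • y, L.carrier.smul_mem a hy, ?_⟩
    rw [smul_add, TensorProduct.tmul_smul, TensorProduct.tmul_smul]

variable (n L)

theorem coe_augmentation_apply (x : L.carrier) :
    ((augmentation n L).toFun x : EuclideanSpace ℝ (Fin 2) ⊗[ℝ] L.V) =
      unitVec n ⊗ₜ[ℝ] (x : L.V) := rfl

theorem coe_differential_apply (z : ((P n).tensor L).carrier) :
    ((differential n L).toFun z : EuclideanSpace ℝ (Fin 2) ⊗[ℝ] L.V) =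
      ((P n).quotProj (intInP n)).rTensor L.V z := rfl

theorem mem_image_augmentation {z : EuclideanSpace ℝ (Fin 2) ⊗[ℝ] L.V} :
    z ∈ image (augmentation n L) ↔ ∃ x ∈ L.carrier, unitVec n ⊗ₜ[ℝ] x = z :=
  ⟨fun ⟨x, hx⟩ => ⟨x, x.2, hx⟩, fun ⟨x, hx, h⟩ => ⟨⟨x, hx⟩, h⟩⟩

theorem rTensor_quotProj_apply (x y : L.V) :
    ((P n).quotProj (intInP n)).rTensor L.V (unitVec n ⊗ₜ[ℝ] x + genB n ⊗ₜ[ℝ] y) =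
      (P n).quotProj (intInP n) (genB n) ⊗ₜ[ℝ] y := by
  rw [map_add]
  change (P n).quotProj (intInP n) (unitVec n) ⊗ₜ[ℝ] x +
    (P n).quotProj (intInP n) (genB n) ⊗ₜ[ℝ] y = _
  rw [quotProj_unitVec, TensorProduct.zero_tmul, zero_add]

theorem isConcreteExact_resolution :
    IsConcreteExact (augmentation n L) (differential n L) := by
  refine ⟨fun x => ?_, fun z => ?_, ?_, fun z => ?_⟩
  · rw [coe_augmentation_apply, TensorProduct.norm_tmul, norm_unitVec, one_mul]
  · obtain ⟨x, hx, y, hy, hz⟩ := exists_eq_of_mem_tensor z.2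
    have h1 := coe_differential_apply n L z
    rw [hz, rTensor_quotProj_apply] at h1
    rw [mem_image_augmentation, ← Submodule.coe_eq_zero, h1]
    constructor
    · intro h2
      have h3 := congrArg norm h2
      rw [TensorProduct.norm_tmul, norm_zero, mul_eq_zero, norm_eq_zero, norm_eq_zero] at h3
      refine ⟨x, hx, ?_⟩
      rw [hz]
      rcases h3 with h3 | h3
      · rw [genB_eq_zero_of_quotProj n h3, TensorProduct.zero_tmul, add_zero]
      · rw [h3, TensorProduct.tmul_zero, add_zero]
    · rintro ⟨x', -, h2⟩
      rw [← h1, coe_differential_apply, ← h2]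
      change (P n).quotProj (intInP n) (unitVec n) ⊗ₜ[ℝ] x' = 0
      rw [quotProj_unitVec, TensorProduct.zero_tmul]
  · have h1 : ((PModInt n).tensor L).carrier ≤ image (differential n L) := by
      refine Submodule.span_le.2 ?_
      rintro _ ⟨_, ⟨x, hx, rfl⟩, y, hy, rfl⟩
      exact ⟨⟨x ⊗ₜ[ℝ] y, Submodule.subset_span ⟨x, hx, y, hy, rfl⟩⟩, rfl⟩
    intro c
    obtain ⟨z, hz⟩ := h1 c.2
    exact ⟨z, Subtype.ext hz⟩
  · obtain ⟨x, hx, y, hy, hz⟩ := exists_eq_of_mem_tensor z.2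
    obtain ⟨κ, hκ⟩ := exists_smul_add_quotProj n (genB n)
    have h1 : (z : EuclideanSpace ℝ (Fin 2) ⊗[ℝ] L.V) -
        (unitVec n ⊗ₜ[ℝ] x + κ • (unitVec n ⊗ₜ[ℝ] y)) =
        (P n).quotProj (intInP n) (genB n) ⊗ₜ[ℝ] y := by
      rw [hz]
      nth_rw 1 [hκ]
      rw [TensorProduct.add_tmul, TensorProduct.smul_tmul']
      abel
    refine ⟨unitVec n ⊗ₜ[ℝ] x + κ • (unitVec n ⊗ₜ[ℝ] y), ?_, fun w hw => ?_, ?_⟩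
    · exact Submodule.add_mem _
        (Submodule.subset_span ((mem_image_augmentation n L).2 ⟨x, hx, rfl⟩))
        (Submodule.smul_mem _ _
          (Submodule.subset_span ((mem_image_augmentation n L).2 ⟨y, hy, rfl⟩)))
    · obtain ⟨x', -, rfl⟩ := (mem_image_augmentation n L).1 hw
      rw [h1, TensorProduct.inner_tmul, inner_quotProj_unitVec, zero_mul]
    · rw [h1, coe_differential_apply, hz, rTensor_quotProj_apply]

/-! ### Tightness of the resolution -/

variable {n L}

theorem span_tmul_eq_tensor {M : EucLat.{v}} {ι κ : Type*} {a : ι → M.V} {b : κ → L.V}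
    (ha : Submodule.span ℤ (Set.range a) = M.carrier)
    (hb : Submodule.span ℤ (Set.range b) = L.carrier) :
    Submodule.span ℤ (Set.range fun p : ι × κ => a p.1 ⊗ₜ[ℝ] b p.2) = (M.tensor L).carrier := by
  let T : M.V →ₗ[ℤ] L.V →ₗ[ℤ] (M.V ⊗[ℝ] L.V) := (TensorProduct.mk ℝ M.V L.V).restrictScalars₁₂ ℤ ℤ
  have h1 := Submodule.map₂_span_span ℤ T (Set.range a) (Set.range b)
  rw [ha, hb, Submodule.map₂_eq_span_image2] at h1
  have h2 : (Set.range fun p : ι × κ => a p.1 ⊗ₜ[ℝ] b p.2) =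
      Set.image2 (fun x y => T x y) (Set.range a) (Set.range b) := by
    ext z
    simp [T, Set.mem_image2]
  rw [h2]
  exact h1.symm

variable (n)

theorem norm_genA : ‖genA n‖ = 1 / n := by
  rw [EuclideanSpace.norm_eq, Fin.sum_univ_two]
  simp [genA]

theorem norm_genB_le : ‖genB n‖ ≤ 1 / n := by
  have hn : (0 : ℝ) < n := by exact_mod_cast n.pos
  rw [EuclideanSpace.norm_eq, Fin.sum_univ_two]
  simp only [genB, Matrix.cons_val_zero, Matrix.cons_val_one, norm_zero, Real.norm_eq_abs, sq_abs]
  refine Real.sqrt_le_iff.2 ⟨by positivity, ?_⟩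
  have h1 : √(1 / (n : ℝ) ^ 2 - 1 / (n : ℝ) ^ 4) ^ 2 ≤ √(1 / (n : ℝ) ^ 2) ^ 2 := by
    gcongr
    exact sub_le_self _ (by positivity)
  rw [Real.sq_sqrt (x := 1 / (n : ℝ) ^ 2) (by positivity)] at h1
  rw [div_pow, one_pow]
  linarith

/-- The lattices `P_n` and `P_n / ℤ` are generated by two vectors of norm at most `1 / n`. -/
theorem exists_generators {M : EucLat.{0}} (hM : M = P n ∨ M = PModInt n) :
    ∃ a : Fin 2 → M.V, Submodule.span ℤ (Set.range a) = M.carrier ∧ ∀ i, ‖a i‖ ≤ 1 / n := by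
  have ha : Submodule.span ℤ (Set.range ![genA n, genB n]) = (P n).carrier := by
    rw [Matrix.range_cons_cons_empty]
  have hn (i : Fin 2) : ‖![genA n, genB n] i‖ ≤ 1 / n := by
    fin_cases i
    · exact (norm_genA n).le
    · exact norm_genB_le n
  rcases hM with rfl | rfl
  · exact ⟨_, ha, hn⟩
  · refine ⟨fun i => (P n).quotProj (intInP n) (![genA n, genB n] i), ?_, fun i => ?_⟩
    · change _ = (P n).carrier.map _
      rw [← ha, Submodule.map_span, ← Set.range_comp]
      rfl
    · exact (Submodule.norm_starProjection_apply_le _ _).trans (hn i)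

theorem isTight_of_span {L : EucLat.{u}} {δ : ℝ} (hδ : 0 < δ) {S : Set L.V}
    (hS : Submodule.span ℤ S = L.carrier) {D : ℕ} (hD : Module.finrank ℝ L.V ≤ D)
    (h : ∀ x ∈ S, ‖x‖ ≤ δ / (D : ℝ) ^ 2) : L.IsTight δ := by
  -- For the zero lattice `d = 0` and the bound `δ / d²` is 0 by convention, so the empty generating
  -- set is used.
  by_cases hL : L.carrier = ⊥
  · exact ⟨∅, by rw [hL, Submodule.span_empty], by simp⟩
  · refine ⟨S, hS, fun x hx => (h x hx).trans ?_⟩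
    set W := Submodule.span ℝ (L.carrier : Set L.V) with hW
    have h1 : W ≠ ⊥ := fun h0 => hL <| by
      rw [eq_bot_iff]
      exact fun y hy => (Submodule.mem_bot ℝ).1 (h0 ▸ Submodule.subset_span hy)
    have h2 : 0 < Module.finrank ℝ W :=
      Nat.pos_of_ne_zero fun h0 => h1 (Submodule.finrank_eq_zero.1 h0)
    have h3 : Module.finrank ℝ W ≤ D := (Submodule.finrank_le W).trans hD
    gcongr

variable (L)

/-- A family of generators of `M ⊗ L`, for `M` equal to `P_n` or `P_n / ℤ`. -/
theorem exists_generators_tensor : ∃ (d : ℕ) (c : ℝ), 0 ≤ c ∧ ∀ (n : ℕ+) (M : EucLat.{0}),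
    M = P n ∨ M = PModInt n → ∃ a : Fin 2 × Fin d → (M.tensor L).V,
      Submodule.span ℤ (Set.range a) = (M.tensor L).carrier ∧ ∀ i, ‖a i‖ ≤ c / n := by
  obtain ⟨d, b, -, hb⟩ := exists_linearIndependent_span_int L.carrier
  refine ⟨d, ∑ i, ‖b i‖, by positivity, fun n M hM => ?_⟩
  obtain ⟨a, ha, hn⟩ := exists_generators n hM
  refine ⟨_, span_tmul_eq_tensor ha hb, fun i => ?_⟩
  rw [TensorProduct.norm_tmul, div_eq_mul_one_div, mul_comm]
  gcongr
  · exact Finset.single_le_sum (f := fun i => ‖b i‖) (fun _ _ => norm_nonneg _)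
      (Finset.mem_univ i.2)
  · exact hn i.1

theorem tendsto_div_pnat (c : ℝ) : Tendsto (fun n : ℕ+ => c / (n : ℝ)) atTop (𝓝 0) :=
  (tendsto_const_div_atTop_nhds_zero_nat c).comp tendsto_PNat_val_atTop_atTop

theorem eventually_isTight {δ : ℝ} (hδ : 0 < δ) : ∀ᶠ n : ℕ+ in atTop,
    ((P n).tensor L).IsTight δ ∧ ((PModInt n).tensor L).IsTight δ := by
  obtain ⟨d, c, -, h⟩ := exists_generators_tensor L
  -- The summand 1 keeps `D` positive when the ambient space is zero.
  set D := 2 * Module.finrank ℝ L.V + 1 with hD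
  have h1 : 0 < δ / (D : ℝ) ^ 2 := by positivity
  filter_upwards [(tendsto_div_pnat c).eventually_le_const h1] with n hn
  have h2 : Module.finrank ℝ (EuclideanSpace ℝ (Fin 2) ⊗[ℝ] L.V) ≤ D := by
    rw [Module.finrank_tensorProduct, finrank_euclideanSpace_fin]
    omega
  constructor
  · obtain ⟨a, ha, hle⟩ := h n (P n) (Or.inl rfl)
    exact isTight_of_span hδ ha h2 (Set.forall_mem_range.2 fun i => (hle i).trans hn)
  · obtain ⟨a, ha, hle⟩ := h n (PModInt n) (Or.inr rfl)
    exact isTight_of_span hδ ha h2 (Set.forall_mem_range.2 fun i => (hle i).trans hn)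

theorem exists_cohomology_one_le : ∃ r : ℕ+ → ℝ, Tendsto r atTop (𝓝 0) ∧ ∀ (n : ℕ+)
    (M : EucLat.{0}), M = P n ∨ M = PModInt n → cohomology 1 (M.tensor L) ≤ r n := by
  obtain ⟨d, c, hc, h⟩ := exists_generators_tensor L
  refine ⟨fun n => Real.pi * ((2 * d : ℝ) * c / n) ^ 2, ?_, fun n M hM => ?_⟩
  · have := ((tendsto_div_pnat ((2 * d : ℝ) * c)).pow 2).const_mul Real.pi
    simpa using this
  · obtain ⟨a, ha, hle⟩ := h n M hM
    refine (cohomology_one_le _ (covers_of_span a ha)).trans ?_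
    have hp := Real.pi_pos
    have h1 : ∑ i, ‖a i‖ ≤ (2 * d : ℝ) * c / n := by
      refine (Finset.sum_le_card_nsmul _ _ (c / n) fun i _ => hle i).trans (le_of_eq ?_)
      simp
      ring
    exact mul_le_mul_of_nonneg_left (pow_le_pow_left₀ (by positivity) h1 2) hp.le

/-! ### The limit of the cohomology of the resolutions -/

theorem ell_ker_differential : (ker (differential n L)).ell = L.ell := by
  have h := isConcreteExact_resolution n L
  have h1 : (ker (differential n L)).carrier = image (augmentation n L) := by
    ext z
    constructor
    · rintro ⟨y, hy, rfl⟩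
      exact (h.exact y).1 hy
    · intro hz
      exact ⟨⟨z, image_le _ hz⟩, (h.exact ⟨z, image_le _ hz⟩).2 hz, rfl⟩
  rw [ell_eq_logTheta, h1, logTheta_image h, ell_eq_logTheta]

theorem nul_zero (A B : EucLat.{u}) : nul (0 : A ⟶ B) = A.ell := by
  have h1 : (ker (0 : A ⟶ B)).carrier = A.carrier :=
    le_antisymm (ker_le _) fun x hx => ⟨⟨x, hx⟩, rfl, rfl⟩
  rw [nul, ell_eq_logTheta, h1, ell_eq_logTheta]

theorem rk_zero (A B : EucLat.{u}) : rk (0 : A ⟶ B) = 0 := by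
  have h : (ker (0 : A ⟶ B)).ell = A.ell := nul_zero A B
  rw [rk, h, sub_self]

theorem ell_zero : zero.{u}.ell = 0 := by
  rw [ell_eq_logTheta]
  exact logTheta_bot 1

theorem complexCohomology_resolution_zero :
    complexCohomology (resolution n L) 0 = L.ell := by
  have h1 : (resolution n L).d 0 1 = differential n L :=
    CochainComplex.of_d (resolutionX n L) (resolutionD n L) 0
  rw [complexCohomology, rk_zero, sub_zero, h1]
  exact ell_ker_differential n L

theorem complexCohomology_resolution_one :
    complexCohomology (resolution n L) 1 =
      ((PModInt n).tensor L).ell - (((P n).tensor L).ell - L.ell) := by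
  have h1 : (resolution n L).d 0 1 = differential n L :=
    CochainComplex.of_d (resolutionX n L) (resolutionD n L) 0
  have h2 : (resolution n L).d 1 2 = 0 :=
    CochainComplex.of_d (resolutionX n L) (resolutionD n L) 1
  rw [complexCohomology, h1, h2, nul_zero, ← ell_ker_differential n L]
  rfl

theorem complexCohomology_resolution_add_two (k : ℕ) :
    complexCohomology (resolution n L) (k + 2) = 0 := by
  have h1 (k : ℕ) : (resolution n L).d (k + 1) (k + 2) = 0 :=
    CochainComplex.of_d (resolutionX n L) (resolutionD n L) (k + 1)
  rw [complexCohomology, h1, h1, nul_zero, rk_zero, sub_zero]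
  exact ell_zero

theorem tendsto_complexCohomology (k : ℕ) :
    Tendsto (fun n : ℕ+ => complexCohomology (resolution n L) k) atTop (𝓝 (cohomology k L)) :=
  match k with
  | 0 => by
    simp only [complexCohomology_resolution_zero]
    exact tendsto_const_nhds
  | 1 => by
    obtain ⟨r, hr, hle⟩ := exists_cohomology_one_le L
    -- The densities of the three terms of the resolution cancel, leaving `h¹(L)` plus two error
    -- terms bounded by `r n`.
    have h1 (n : ℕ+) : complexCohomology (resolution n L) 1 = cohomology 1 L +
        cohomology 1 ((PModInt n).tensor L) - cohomology 1 ((P n).tensor L) := by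
      rw [complexCohomology_resolution_one, cohomology, cohomology, cohomology,
        logDensity_add (isConcreteExact_resolution n L)]
      ring
    refine tendsto_of_tendsto_of_tendsto_of_le_of_le (g := fun n => cohomology 1 L - r n)
      (h := fun n => cohomology 1 L + r n) ?_ ?_ (fun n => ?_) fun n => ?_
    · simpa using hr.const_sub (cohomology 1 L)
    · simpa using hr.const_add (cohomology 1 L)
    all_goals
      have h2 := hle n _ (Or.inl rfl)
      have h3 := hle n _ (Or.inr rfl)
      have h4 := cohomology_nonneg 1 ((P n).tensor L)
      have h5 := cohomology_nonneg 1 ((PModInt n).tensor L)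
      simp only [h1]
      linarith
  | k + 2 => by
    simp only [complexCohomology_resolution_add_two]
    exact tendsto_const_nhds

theorem isEffaceable_cohomology (i : ℕ) :
    IsEffaceable (ShortExactTriple EucLat.{u}) (cohomology.{u} (i + 1)) := by
  intro A ε hε
  obtain ⟨r, hr, hle⟩ := exists_cohomology_one_le A
  obtain ⟨n, hn⟩ := (hr.eventually_le_const hε).exists
  refine ⟨(P n).tensor A, (PModInt n).tensor A,
    ⟨_, _, (isConcreteExact_resolution n A).isShortExact⟩, ?_⟩
  match i with
  | 0 => exact (hle n _ (Or.inl rfl)).trans hn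
  | _ + 1 => exact hε.le

theorem isEffaceableDeltaFunctor_cohomology :
    IsEffaceableDeltaFunctor (ShortExactTriple EucLat.{u}) cohomology.{u} :=
  ⟨isNumericalDeltaFunctor_cohomology, fun i hi => by
    obtain ⟨j, rfl⟩ := Nat.exists_eq_add_of_le' hi
    exact isEffaceable_cohomology j⟩

end Resolution

end EucLat

theorem mainTheorem1 :
    -- the Gaussian sums converge, `rk` is a rank, and `rk (id_L) = ℓ(L)`
    (∀ L : EucLat.{u}, Summable fun x : L.carrier => Real.exp (-Real.pi * ‖(x : L.V)‖ ^ 2)) ∧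
    IsRank EucLat.rk.{u} ∧
    (∀ L : EucLat.{u}, EucLat.rk (𝟙 L) = L.ell) ∧
    -- `R_{(L,n)}` is a resolution of `L`, and its terms are arbitrarily tight for large `n`
    (∀ (n : ℕ+) (L : EucLat.{u}),
      IsShortExact (EucLat.augmentation n L) (EucLat.differential n L)) ∧
    (∀ (L : EucLat.{u}) (δ : ℝ), 0 < δ → ∀ᶠ n : ℕ+ in atTop,
      ((EucLat.P n).tensor L).IsTight δ ∧ ((EucLat.PModInt n).tensor L).IsTight δ) ∧
    -- cohomology exists, is the limit of the cohomology of the resolutions, and is unique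
    ∃ h : ℕ → EucLat.{u} → ℝ,
      IsEffaceableDeltaFunctor (ShortExactTriple EucLat.{u}) h ∧
      h 0 = EucLat.ell ∧
      (∀ (k : ℕ) (L : EucLat.{u}),
        Tendsto (fun n : ℕ+ => EucLat.complexCohomology (EucLat.resolution n L) k) atTop
          (𝓝 (h k L))) ∧
      ∀ T : ℕ → EucLat.{u} → ℝ,
        IsEffaceableDeltaFunctor (ShortExactTriple EucLat.{u}) T → T 0 = EucLat.ell → T = h := by
  refine ⟨fun L => ?_, EucLat.isRank_rk, EucLat.rk_id,
    fun n L => (EucLat.isConcreteExact_resolution n L).isShortExact,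
    fun L δ hδ => EucLat.eventually_isTight L hδ, EucLat.cohomology,
    EucLat.isEffaceableDeltaFunctor_cohomology, rfl,
    fun k L => EucLat.tendsto_complexCohomology L k,
    fun T hT h0 => hT.unique EucLat.isEffaceableDeltaFunctor_cohomology h0⟩
  simpa only [neg_mul] using summable_exp_neg_norm_sq L.carrier Real.pi_pos
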